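/- **Notation.** For $\Theta\subset\mathbb R^m$ and $\bar x\in\Theta$, the regular normal cone is $\widehat N(\bar x;\Theta)=\{x^*\mid\limsup_{x\to\bar x,\,x\in\Theta}\langle x^*,x-\bar x\rangle/\|x-\bar x\|\le0\}$. The limiting normal cone $N(\bar x;\Theta)$ is the set of limits of sequences $x_k^*\in\widehat N(x_k;\Theta)$ with $x_k\in\Theta$, $x_k\to\bar x$. The set $\Theta$ is normally regular at $\bar x$ if the two cones coincide. The tangent (contingent) cone $T(\bar x;\Theta)$ is the set of limits of sequences $w_k$ with $\bar x+\tau_kw_k\in\Theta$ for some $\tau_k\downarrow0$. For $\varphi:\mathbb R^n\to(-\infty,\infty]$ and $\varphi(\bar x)<\infty$ put $\partial\varphi(\bar x)=\{x^*\mid(x^*,-1)\in N((\bar x,\varphi(\bar x));\mathrm{epi}\,\varphi)\}$ and $\partial^\infty\varphi(\bar x)=\{x^*\mid(x^*,0)\in N((\bar x,\varphi(\bar x));\mathrm{epi}\,\varphi)\}$; both sets are empty if $\varphi(\bar x)=\infty$. Write $\mathrm{cone}\,S=\{\lambda v\mid\lambda\ge0,\ v\in S\}$. The integral $\int_AF\,d\mu$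 of a set-valued mapping $F$ is the set of all integrals $\int_Ax^*\,d\mu$ of integrable $x^*$ with $x^*(\omega)\in F(\omega)$ for almost all $\omega\in A$ (Aumann integral), and $\mathrm{cl}$ denotes closure. **Setting.** Let $(\Omega,\mathcal A,\mu)$ be a complete $\sigma$-finite measure space. Let $f:\Omega\times\mathbb R^n\to(-\infty,\infty]$ be a normal integrand, i.e. $f$ is $\mathcal A\otimes\mathcal B(\mathbb R^n)$-measurable and $f_\omega:=f(\omega,\cdot)$ is lower semicontinuous for every $\omega$. Let $\bar x\in\mathbb R^n$, and assume that for almost all $\omega$ the function $f_\omega$ is finite and Lipschitz continuous on a neighborhood of $\bar x$ (both may depend on $\omega$). Put $M(\omega)=\{x\in\mathbb R^n\mid f(\omega,x)\le0\}$, where $M$ is measurable (that is, $\{\omega\mid M(\omega)\cap U\neq\emptyset\}\in\mathcal A$ for all open $U$). Let $M_\cap=\{x\mid x\in M(\omega)\text{ for a.e. }\omega\}$ and $\Omega_f=\{\omega\in\Omega\mid f(\omega,\bar x)=0\}$. Let $h:\mathbb R^n\to(-\infty,\infty]$ be lower semicontinuous around $\bar x$, and let $\bar x\in M_\cap$ be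 a local minimizer of $h$ over $M_\cap$. **Statement.** Consider the qualification condition $$(-\partial^\infty h(\bar x))\cap\mathrm{cl}\Big(\int_{\Omega_f}\mathrm{cone}\,\partial f_\omega(\bar x)\,d\mu(\omega)\Big)=\{0\}\tag{Q}$$ and the optimality condition $$0\in\partial h(\bar x)+\mathrm{cl}\Big(\int_{\Omega_f}\mathrm{cone}\,\partial f_\omega(\bar x)\,d\mu(\omega)\Big).\tag{O}$$ (i) Assume that $M_\cap$ is normally regular at $\bar x$, that $T(\bar x;M_\cap)=\{w\mid w\in T(\bar x;M(\omega))\text{ for a.e. }\omega\in\Omega\}$ (the measurable conical hull intersection property), that $0\notin\partial f_\omega(\bar x)$ for almost all $\omega\in\Omega_f$, and that (Q) holds. Then (O) holds. (ii) Assume that $\bar x=0$, that for almost all $\omega\in\Omega$ one has $f(\omega,\lambda x)\le\lambda f(\omega,x)$ for all $\lambda\ge0$ and all $x\in\mathbb R^n$ (with $0\cdot\infty=0$), and that (Q) holds. Then (O) holds. -/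

import Mathlib

open Set Filter Topology MeasureTheory
open scoped Pointwise NNReal ENNReal

namespace StochVar

noncomputable section

section Cones

variable {H : Type*} [NormedAddCommGroup H] [InnerProductSpace ℝ H]

/-- The regular (Fréchet) normal cone to `Θ` at `x`: the vectors `v` such that the upper limit of
`⟪v, y - x⟫ / ‖y - x‖` as `y → x` with `y ∈ Θ` is at most `0`. It is empty if `x ∉ Θ`. -/
def regularNormalCone (x : H) (Θ : Set H) : Set H :=
  {v | x ∈ Θ ∧ ∀ ε : ℝ, 0 < ε → ∀ᶠ y in 𝓝[Θ] x, inner ℝ v (y - x) ≤ ε * ‖y - x‖}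

/-- The limiting (Mordukhovich) normal cone to `Θ` at `x`: the sequential outer limit of the regular
normal cones at points of `Θ` tending to `x`. It is empty if `x ∉ Θ`. -/
def limitingNormalCone (x : H) (Θ : Set H) : Set H :=
  {v | x ∈ Θ ∧ ∃ (y : ℕ → H) (w : ℕ → H), (∀ k, y k ∈ Θ) ∧ (∀ k, w k ∈ regularNormalCone (y k) Θ) ∧
    Tendsto y atTop (𝓝 x) ∧ Tendsto w atTop (𝓝 v)}

/-- `Θ` is normally regular at `x`. -/
def NormallyRegularAt (Θ : Set H) (x : H) : Prop :=
  regularNormalCone x Θ = limitingNormalCone x Θ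

/-- The contingent (Bouligand–Severi tangent) cone to `Θ` at `x`: the sequential outer limit of
`(Θ - x) / τ` as `τ ↓ 0`. -/
def contingentCone (x : H) (Θ : Set H) : Set H :=
  {w | ∃ (τ : ℕ → ℝ) (u : ℕ → H), (∀ k, 0 < τ k) ∧ Tendsto τ atTop (𝓝 0) ∧
    Tendsto u atTop (𝓝 w) ∧ ∀ k, x + τ k • u k ∈ Θ}

/-- The conic hull `{λ v | λ ≥ 0, v ∈ S}`. -/
def conicHull (S : Set H) : Set H :=
  {w | ∃ (t : ℝ) (v : H), 0 ≤ t ∧ v ∈ S ∧ w = t • v}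

/-- The epigraph of an extended-real-valued function, as a subset of the Hilbert space product
`H × ℝ` (Euclidean norm). -/
def epigraph (φ : H → EReal) : Set (WithLp 2 (H × ℝ)) :=
  {p | φ p.fst ≤ (p.snd : EReal)}

/-- The basic (limiting, Mordukhovich) subdifferential of `φ` at `x`. It is empty if `φ x` is not
finite. -/
def basicSubdifferential (φ : H → EReal) (x : H) : Set H :=
  {v | ∃ r : ℝ, φ x = (r : EReal) ∧
    WithLp.toLp 2 (v, (-1 : ℝ)) ∈ limitingNormalCone (WithLp.toLp 2 (x, r)) (epigraph φ)}

/-- The singular subdifferential of `φ` at `x`. It is empty if `φ x` is not finite. -/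
def singularSubdifferential (φ : H → EReal) (x : H) : Set H :=
  {v | ∃ r : ℝ, φ x = (r : EReal) ∧
    WithLp.toLp 2 (v, (0 : ℝ)) ∈ limitingNormalCone (WithLp.toLp 2 (x, r)) (epigraph φ)}

/-- `φ` is finite and Lipschitz continuous on some neighborhood of `x`. -/
def LipschitzAround (φ : H → EReal) (x : H) : Prop :=
  ∃ U ∈ 𝓝 x, ∃ (K : ℝ≥0) (g : H → ℝ), LipschitzOnWith K g U ∧ ∀ y ∈ U, φ y = (g y : EReal)

end Cones

section Multifunctions

variable {Ω : Type*} [MeasurableSpace Ω] {n : ℕ}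

/-- A set-valued mapping is measurable if inverse images of open sets are measurable. -/
def MeasurableMultifunction (M : Ω → Set (EuclideanSpace ℝ (Fin n))) : Prop :=
  ∀ U : Set (EuclideanSpace ℝ (Fin n)), IsOpen U → MeasurableSet {ω | (M ω ∩ U).Nonempty}

/-- The essential intersection of a set-valued mapping. -/
def essInter (μ : Measure Ω) (M : Ω → Set (EuclideanSpace ℝ (Fin n))) :
    Set (EuclideanSpace ℝ (Fin n)) :=
  {x | ∀ᵐ ω ∂μ, x ∈ M ω}

/-- The measurable conical hull intersection property (CHIP) at `x`. -/
def MeasurableCHIP (μ : Measure Ω) (M : Ω → Set (EuclideanSpace ℝ (Fin n)))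
    (x : EuclideanSpace ℝ (Fin n)) : Prop :=
  contingentCone x (essInter μ M) = essInter μ (fun ω => contingentCone x (M ω))

/-- The Aumann integral over `A` of a set-valued mapping: the set of integrals over `A` of the
integrable almost everywhere selections. -/
def aumannIntegral (μ : Measure Ω) (A : Set Ω) (F : Ω → Set (EuclideanSpace ℝ (Fin n))) :
    Set (EuclideanSpace ℝ (Fin n)) :=
  {z | ∃ s : Ω → EuclideanSpace ℝ (Fin n), IntegrableOn s A μ ∧
    (∀ᵐ ω ∂(μ.restrict A), s ω ∈ F ω) ∧ z = ∫ ω in A, s ω ∂μ}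

/-- A normal integrand with values in `(-∞, ∞]`: jointly measurable and lower semicontinuous in the
second variable. -/
structure IsNormalIntegrand (f : Ω → EuclideanSpace ℝ (Fin n) → EReal) : Prop where
  ne_bot : ∀ ω x, f ω x ≠ ⊥
  measurable : Measurable (fun p : Ω × EuclideanSpace ℝ (Fin n) => f p.1 p.2)
  lsc : ∀ ω, LowerSemicontinuous (f ω)

/-- The random inequality constraint sets `{x | f(ω, x) ≤ 0}`. -/
def constraintSet (f : Ω → EuclideanSpace ℝ (Fin n) → EReal) (ω : Ω) :
    Set (EuclideanSpace ℝ (Fin n)) :=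
  {x | f ω x ≤ 0}

/-- The set `{ω | f(ω, x) = 0}` of active indices at `x`. -/
def activeSet (f : Ω → EuclideanSpace ℝ (Fin n) → EReal) (x : EuclideanSpace ℝ (Fin n)) : Set Ω :=
  {ω | f ω x = 0}

/-- The closure of the Aumann integral over the active set of the conic hulls of the basic
subdifferentials of `f(ω, ·)` at `x`. -/
def closedMultiplierSet (μ : Measure Ω) (f : Ω → EuclideanSpace ℝ (Fin n) → EReal)
    (x : EuclideanSpace ℝ (Fin n)) : Set (EuclideanSpace ℝ (Fin n)) :=
  closure (aumannIntegral μ (activeSet f x) (fun ω => conicHull (basicSubdifferential (f ω) x)))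

end Multifunctions

end

end StochVar

/-! The argument splits into a deterministic optimality rule and a description of the normals to the
essential intersection `M_∩`. Optimality rule: under a qualification condition, some limit `ξ` of
proximal normals to `M_∩` at points tending to `x̄` satisfies `-ξ ∈ ∂h(x̄)`. It comes from
decoupling the variables of `h` and of the constraint by a quadratic penalty
(`exists_mem_proximalLimitCone_neg_mem_basicSubdifferential`). It remains to show that every such
`ξ` lies in the closed Aumann integral; (Q) then supplies the qualification.

That inclusion rests on `mem_closure_aumannIntegral`. Suppose a set is the common zero set of
functions `e_ω ≥ 0` having at each point a quadratic upper support with slope `u_ω` in a cone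
`C(ω)`. With a positive integrable weight `d`, the set is the zero set of `E = ∫ d e_ω`, which has
upper supports with slope `∫ d u_ω`. Given a proximal normal `v`, minimizing `-⟨v, y - x⟩ + (c +
1)‖y - x‖² + k E(y)` makes `v` equal to `k ∫ d u_ω` up to an arbitrarily small error.

In (i), normal regularity reduces the problem to regular normals at `x̄`; these are nonpositive on
the contingent cone of `M_∩`, which by CHIP is the essential intersection of the cones `T_ω = T(x̄;
M(ω))`. Take `e_ω = ½ dist²(·, T_ω)`: its slopes are projection residuals, and these lie in `cone
∂f_ω(x̄)` because `0 ∉ ∂f_ω(x̄)` (`sub_mem_conicHull_basicSubdifferential`). In (ii), `f_ω` is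
finite, positively homogeneous and globally Lipschitz. Take for `e_ω` the Moreau envelope of `½
(f_ω⁺)²`, whose zero set is `M(ω)`: its slopes are multiples of proximal subgradients of `f_ω` at
arbitrary points, and by homogeneity these belong to `∂f_ω(0)`. Hence neither regularity nor `0 ∉
∂f_ω` is needed. -/

namespace StochVar

/-! ### Proximal normals, quadratic penalties and the optimality rule. -/

section ProximalNormals

variable {H : Type*} [NormedAddCommGroup H] [InnerProductSpace ℝ H]

/-- `v` is a proximal normal to `Θ` at `x`. -/
def IsProximalNormal (v x : H) (Θ : Set H) : Prop :=
  x ∈ Θ ∧ ∃ C : ℝ, ∀ᶠ y in 𝓝[Θ] x, inner ℝ v (y - x) ≤ C * ‖y - x‖ ^ 2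

/-- `a` is a proximal subgradient of the real-valued function `g` at `x`. -/
def IsProximalSubgradient (g : H → ℝ) (x a : H) : Prop :=
  ∃ C : ℝ, ∀ᶠ y in 𝓝 x, inner ℝ a (y - x) ≤ g y - g x + C * ‖y - x‖ ^ 2

/-- The set of limits of proximal normals to `Θ` at points tending to `x`. -/
def proximalLimitCone (x : H) (Θ : Set H) : Set H :=
  {v | ∃ (y : ℕ → H) (w : ℕ → H), (∀ k, IsProximalNormal (w k) (y k) Θ) ∧
    Tendsto y atTop (𝓝 x) ∧ Tendsto w atTop (𝓝 v)}

theorem IsProximalNormal.mem_regularNormalCone {v x : H} {Θ : Set H}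
    (h : IsProximalNormal v x Θ) : v ∈ regularNormalCone x Θ := by
  obtain ⟨hx, C, hC⟩ := h
  refine ⟨hx, fun ε hε => ?_⟩
  have hball : ∀ᶠ y in 𝓝[Θ] x, ‖y - x‖ < ε / (|C| + 1) := by
    have : ∀ᶠ y in 𝓝 x, ‖y - x‖ < ε / (|C| + 1) := by
      have h0 : 0 < ε / (|C| + 1) := by positivity
      filter_upwards [Metric.ball_mem_nhds x h0] with y hy
      simpa [dist_eq_norm] using hy
    exact this.filter_mono nhdsWithin_le_nhds
  filter_upwards [hC, hball] with y hy hb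
  refine hy.trans ?_
  have h1 : (|C| + 1) * ‖y - x‖ ≤ ε := by
    rw [lt_div_iff₀ (by positivity)] at hb
    linarith
  have h2 : C ≤ |C| + 1 := by linarith [le_abs_self C]
  have h3 := norm_nonneg (y - x)
  nlinarith [mul_le_mul_of_nonneg_right h1 h3, mul_le_mul_of_nonneg_right h2 (sq_nonneg ‖y - x‖)]

theorem IsProximalNormal.smul {v x : H} {Θ : Set H} (h : IsProximalNormal v x Θ) {t : ℝ}
    (ht : 0 ≤ t) : IsProximalNormal (t • v) x Θ := by
  obtain ⟨hx, C, hC⟩ := h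
  refine ⟨hx, t * C, ?_⟩
  filter_upwards [hC] with y hy
  rw [real_inner_smul_left, mul_assoc]
  exact mul_le_mul_of_nonneg_left hy ht

theorem mem_limitingNormalCone_of_eventually {v x : H} {Θ : Set H} (hx : x ∈ Θ) {y w : ℕ → H}
    (hw : ∀ᶠ k in atTop, IsProximalNormal (w k) (y k) Θ) (hy : Tendsto y atTop (𝓝 x))
    (hv : Tendsto w atTop (𝓝 v)) : v ∈ limitingNormalCone x Θ := by
  obtain ⟨N, hN⟩ := eventually_atTop.1 hw
  refine ⟨hx, fun k => y (k + N), fun k => w (k + N), fun k => (hN _ (by omega)).1,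
    fun k => (hN _ (by omega)).mem_regularNormalCone, (tendsto_add_atTop_iff_nat N).2 hy,
    (tendsto_add_atTop_iff_nat N).2 hv⟩

theorem mem_proximalLimitCone_of_eventually {v x : H} {Θ : Set H} {y w : ℕ → H}
    (hw : ∀ᶠ k in atTop, IsProximalNormal (w k) (y k) Θ) (hy : Tendsto y atTop (𝓝 x))
    (hv : Tendsto w atTop (𝓝 v)) : v ∈ proximalLimitCone x Θ := by
  obtain ⟨N, hN⟩ := eventually_atTop.1 hw
  exact ⟨fun k => y (k + N), fun k => w (k + N), fun k => hN _ (by omega),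
    (tendsto_add_atTop_iff_nat N).2 hy, (tendsto_add_atTop_iff_nat N).2 hv⟩

/-- Testing `z = q + t b` and dividing by `t` leaves `‖b‖² ≤ C ‖b‖² t` as `t ↓ 0`. This serves as
the first-order condition at penalty minimizers. -/
theorem eq_zero_of_eventually_inner_le {b q : H} {C : ℝ}
    (h : ∀ᶠ z in 𝓝 q, inner ℝ b (z - q) ≤ C * ‖z - q‖ ^ 2) : b = 0 := by
  have hc : Tendsto (fun t : ℝ => q + t • b) (𝓝[>] 0) (𝓝 q) := by
    have : ContinuousAt (fun t : ℝ => q + t • b) 0 := by fun_prop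
    have h2 := this.tendsto
    simp only [zero_smul, add_zero] at h2
    exact h2.mono_left nhdsWithin_le_nhds
  have h1 : ∀ᶠ t : ℝ in 𝓝[>] 0, ‖b‖ ^ 2 ≤ C * ‖b‖ ^ 2 * t := by
    filter_upwards [hc.eventually h, self_mem_nhdsWithin] with t ht htpos
    have htpos : 0 < t := htpos
    simp only [add_sub_cancel_left, real_inner_smul_right, norm_smul, real_inner_self_eq_norm_sq,
      Real.norm_eq_abs, abs_of_pos htpos] at ht
    have : t * ‖b‖ ^ 2 ≤ t * (C * ‖b‖ ^ 2 * t) := by nlinarith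
    exact le_of_mul_le_mul_left this htpos
  have h2 : Tendsto (fun t : ℝ => C * ‖b‖ ^ 2 * t) (𝓝[>] 0) (𝓝 0) := by
    have : ContinuousAt (fun t : ℝ => C * ‖b‖ ^ 2 * t) 0 := by fun_prop
    have h2 := this.tendsto
    simp only [mul_zero] at h2
    exact h2.mono_left nhdsWithin_le_nhds
  have h3 : ‖b‖ ^ 2 ≤ 0 := ge_of_tendsto h2 h1
  have h4 : ‖b‖ = 0 := by nlinarith [norm_nonneg b]
  exact norm_eq_zero.1 h4

/-- The Euclidean product norm dominates the norm of the first component, so a quadratic error in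
that component is enough; `|C|` covers negative `C`. -/
theorem isProximalNormal_epigraph {φ : H → EReal} {x b : H} {α β C : ℝ} (hx : φ x ≤ α)
    (h : ∀ᶠ p : H × ℝ in 𝓝 (x, α), φ p.1 ≤ p.2 →
      inner ℝ b (p.1 - x) + β * (p.2 - α) ≤ C * ‖p.1 - x‖ ^ 2) :
    IsProximalNormal (WithLp.toLp 2 (b, β)) (WithLp.toLp 2 (x, α)) (epigraph φ) := by
  refine ⟨hx, |C|, ?_⟩
  have hc : Tendsto (fun p : WithLp 2 (H × ℝ) => (p.fst, p.snd)) (𝓝 (WithLp.toLp 2 (x, α)))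
      (𝓝 (x, α)) := by
    have : Continuous (fun p : WithLp 2 (H × ℝ) => (p.fst, p.snd)) := by fun_prop
    exact this.tendsto (WithLp.toLp 2 (x, α))
  filter_upwards [nhdsWithin_le_nhds (hc.eventually h), self_mem_nhdsWithin] with p hp hpe
  have h1 := hp hpe
  have h2 : ‖p - WithLp.toLp 2 (x, α)‖ ^ 2 = ‖p.fst - x‖ ^ 2 + ‖p.snd - α‖ ^ 2 := by
    rw [WithLp.prod_norm_sq_eq_of_L2]; rfl
  have h3 : inner ℝ (WithLp.toLp 2 (b, β)) (p - WithLp.toLp 2 (x, α)) =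
      inner ℝ b (p.fst - x) + β * (p.snd - α) := by
    rw [WithLp.prod_inner_apply]
    simp [mul_comm]
  rw [h2, h3]
  refine h1.trans ?_
  have := le_abs_self C
  have h4 := abs_nonneg C
  nlinarith [sq_nonneg ‖p.fst - x‖, sq_nonneg ‖p.snd - α‖, mul_nonneg h4 (sq_nonneg ‖p.snd - α‖),
    mul_le_mul_of_nonneg_right this (sq_nonneg ‖p.fst - x‖)]

theorem IsProximalSubgradient.isProximalNormal {φ : H → EReal} {g : H → ℝ} {q a : H}
    (ha : IsProximalSubgradient g q a) (hφ : ∀ᶠ y in 𝓝 q, φ y = (g y : EReal)) :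
    IsProximalNormal (WithLp.toLp 2 (a, (-1 : ℝ))) (WithLp.toLp 2 (q, g q)) (epigraph φ) := by
  obtain ⟨C, hC⟩ := ha
  refine isProximalNormal_epigraph (C := C) hφ.self_of_nhds.le ?_
  have hc : Tendsto (fun p : H × ℝ => p.1) (𝓝 (q, g q)) (𝓝 q) := continuous_fst.tendsto _
  filter_upwards [hc.eventually hC, hc.eventually hφ] with p h1 h2 h3
  rw [h2] at h3
  have h3 := EReal.coe_le_coe_iff.1 h3
  linarith

theorem mem_basicSubdifferential_of_tendsto {φ : H → EReal} {g : H → ℝ} {x a : H}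
    (hφ : ∀ᶠ y in 𝓝 x, φ y = (g y : EReal)) (hg : ContinuousAt g x) {q b : ℕ → H}
    (hb : ∀ k, IsProximalSubgradient g (q k) (b k)) (hq : Tendsto q atTop (𝓝 x))
    (hba : Tendsto b atTop (𝓝 a)) : a ∈ basicSubdifferential φ x := by
  refine ⟨g x, hφ.self_of_nhds, ?_⟩
  refine mem_limitingNormalCone_of_eventually (y := fun k => WithLp.toLp 2 (q k, g (q k)))
    (w := fun k => WithLp.toLp 2 (b k, (-1 : ℝ))) hφ.self_of_nhds.le ?_ ?_ ?_
  · filter_upwards [hq.eventually hφ.eventually_nhds] with k hk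
    exact (hb k).isProximalNormal hk
  · exact ((WithLp.prod_continuous_toLp 2 H ℝ).tendsto _).comp
      (hq.prodMk_nhds (hg.tendsto.comp hq))
  · exact ((WithLp.prod_continuous_toLp 2 H ℝ).tendsto _).comp (hba.prodMk_nhds tendsto_const_nhds)

/-- Proximal subgradients are bounded by a local Lipschitz constant. -/
theorem IsProximalSubgradient.norm_le {g : H → ℝ} {q a : H} (ha : IsProximalSubgradient g q a)
    {K : ℝ} (hK0 : 0 ≤ K) (hK : ∀ᶠ y in 𝓝 q, |g y - g q| ≤ K * ‖y - q‖) : ‖a‖ ≤ K := by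
  obtain ⟨C, hC⟩ := ha
  have hc : Tendsto (fun t : ℝ => q + t • a) (𝓝[>] 0) (𝓝 q) := by
    have : ContinuousAt (fun t : ℝ => q + t • a) 0 := by fun_prop
    have h2 := this.tendsto
    simp only [zero_smul, add_zero] at h2
    exact h2.mono_left nhdsWithin_le_nhds
  have h1 : ∀ᶠ t : ℝ in 𝓝[>] 0, ‖a‖ ^ 2 ≤ K * ‖a‖ + C * ‖a‖ ^ 2 * t := by
    filter_upwards [hc.eventually hC, hc.eventually hK, self_mem_nhdsWithin] with t ht hk htpos
    have htpos : 0 < t := htpos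
    simp only [add_sub_cancel_left, real_inner_smul_right, norm_smul, real_inner_self_eq_norm_sq,
      Real.norm_eq_abs, abs_of_pos htpos] at ht hk
    have h3 := (le_abs_self _).trans hk
    have : t * ‖a‖ ^ 2 ≤ t * (K * ‖a‖ + C * ‖a‖ ^ 2 * t) := by nlinarith
    exact le_of_mul_le_mul_left this htpos
  have h2 : Tendsto (fun t : ℝ => K * ‖a‖ + C * ‖a‖ ^ 2 * t) (𝓝[>] 0) (𝓝 (K * ‖a‖)) := by
    have : ContinuousAt (fun t : ℝ => K * ‖a‖ + C * ‖a‖ ^ 2 * t) 0 := by fun_prop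
    have h2 := this.tendsto
    simp only [mul_zero, add_zero] at h2
    exact h2.mono_left nhdsWithin_le_nhds
  have h3 : ‖a‖ ^ 2 ≤ K * ‖a‖ := ge_of_tendsto h2 h1
  by_contra! hlt
  nlinarith [norm_nonneg a]

/-- A quadratic minorant of the squared positive part of a locally Lipschitz function comes from a
multiple of a proximal subgradient. -/
theorem eq_zero_or_eq_smul_of_posPart_sq {g : H → ℝ} {q b : H} {L C k : ℝ} (hk : 0 < k)
    (hL : ∀ᶠ z in 𝓝 q, |g z - g q| ≤ L * ‖z - q‖)
    (h : ∀ᶠ z in 𝓝 q, inner ℝ b (z - q) ≤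
      k / 2 * (max (g z) 0 ^ 2 - max (g q) 0 ^ 2) + C * ‖z - q‖ ^ 2) :
    b = 0 ∨ ∃ (t : ℝ) (a : H), 0 ≤ t ∧ IsProximalSubgradient g q a ∧ b = t • a := by
  -- If `g q ≤ 0`, the squared positive part is quadratically small near `q`, so the slope vanishes.
  -- If `g q > 0`, it is at most `g²` with equality at `q`, and expanding `g z ^ 2` about `g q`
  -- gives the multiplier `k * g q`.
  rcases le_or_gt (g q) 0 with hq | hq
  · left
    refine eq_zero_of_eventually_inner_le (C := k / 2 * L ^ 2 + C) (q := q) ?_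
    filter_upwards [hL, h] with z h1 h2
    rw [max_eq_right hq] at h2
    have h3 : max (g z) 0 ≤ L * ‖z - q‖ :=
      max_le (by linarith [le_abs_self (g z - g q)]) ((abs_nonneg _).trans h1)
    have h4 : max (g z) 0 ^ 2 ≤ (L * ‖z - q‖) ^ 2 := pow_le_pow_left₀ (le_max_right _ _) h3 2
    nlinarith
  · right
    have hkq : 0 < k * g q := mul_pos hk hq
    refine ⟨k * g q, (k * g q)⁻¹ • b, hkq.le, ⟨(k * g q)⁻¹ * (k / 2 * L ^ 2 + C), ?_⟩, ?_⟩
    · filter_upwards [hL, h] with z h1 h2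
      rw [max_eq_left hq.le] at h2
      have h3 : max (g z) 0 ^ 2 ≤ g z ^ 2 := by
        rcases le_total (g z) 0 with h0 | h0
        · rw [max_eq_right h0]; nlinarith
        · rw [max_eq_left h0]
      have h4 : (g z - g q) ^ 2 ≤ L ^ 2 * ‖z - q‖ ^ 2 := by
        rw [← mul_pow, ← sq_abs]
        exact pow_le_pow_left₀ (abs_nonneg _) h1 2
      have h5 : inner ℝ b (z - q) ≤
          k * g q * (g z - g q) + (k / 2 * L ^ 2 + C) * ‖z - q‖ ^ 2 := by
        nlinarith [mul_le_mul_of_nonneg_left h3 hk.le, mul_le_mul_of_nonneg_left h4 hk.le]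
      rw [real_inner_smul_left]
      have h6 := mul_le_mul_of_nonneg_left h5 (inv_nonneg.2 hkq.le)
      rw [mul_add, ← mul_assoc, inv_mul_cancel₀ hkq.ne', one_mul, ← mul_assoc] at h6
      exact h6
    · rw [smul_smul, mul_inv_cancel₀ hkq.ne', one_smul]

/-- Quadratic penalization of the zero set of a nonnegative continuous function. -/
theorem exists_penalty_minimizer [ProperSpace H] {x v : H} {c r η : ℝ} (hr : 0 < r) {E : H → ℝ}
    (hE : ContinuousOn E (Metric.closedBall x r)) (hE0 : ∀ y ∈ Metric.closedBall x r, 0 ≤ E y)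
    (hEx : E x = 0)
    (hv : ∀ y ∈ Metric.closedBall x r, E y = 0 → inner ℝ v (y - x) ≤ c * ‖y - x‖ ^ 2)
    (hη : 0 < η) :
    ∃ k : ℝ, 0 < k ∧ ∃ y : H, ‖y - x‖ < η ∧ ∀ z ∈ Metric.closedBall x r,
      -inner ℝ v (y - x) + (c + 1) * ‖y - x‖ ^ 2 + k * E y ≤
        -inner ℝ v (z - x) + (c + 1) * ‖z - x‖ ^ 2 + k * E z := by
  -- Otherwise, for every penalty `m + 1`, the minimizer stays at distance at least `η` from `x`. A
  -- cluster point then has `E = 0` and `R ≥ 0`, while `hv` gives `R ≤ -‖y' - x‖²`; the extra `1` in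
  -- `c + 1` provides this strictness.
  by_contra! hcon
  have hcomp : IsCompact (Metric.closedBall x r) := isCompact_closedBall x r
  have hxm : x ∈ Metric.closedBall x r := Metric.mem_closedBall_self hr.le
  set R : H → ℝ := fun y => inner ℝ v (y - x) - (c + 1) * ‖y - x‖ ^ 2 with hR
  have hRc : Continuous R := by fun_prop
  have hex : ∀ m : ℕ, ∃ y ∈ Metric.closedBall x r, η ≤ ‖y - x‖ ∧ ((m : ℝ) + 1) * E y ≤ R y := by
    intro m
    obtain ⟨y, hy, hmin⟩ := hcomp.exists_isMinOn ⟨x, hxm⟩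
      (f := fun y => -inner ℝ v (y - x) + (c + 1) * ‖y - x‖ ^ 2 + ((m : ℝ) + 1) * E y)
      (by fun_prop)
    refine ⟨y, hy, ?_, ?_⟩
    · by_contra! hlt
      obtain ⟨z, hz, hz'⟩ := hcon (m + 1) (by positivity) y hlt
      exact absurd (hmin hz) (not_le.2 hz')
    · have := hmin hxm
      simp only [mem_ofPred_eq, sub_self, inner_zero_right, norm_zero, hEx] at this
      simp only [hR]
      linarith
  choose y hy hyη hyR using hex
  obtain ⟨y', hy', φ, hφ, hlim⟩ := hcomp.tendsto_subseq hy
  have hRlim : Tendsto (fun m => R (y (φ m))) atTop (𝓝 (R y')) := (hRc.tendsto _).comp hlim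
  have hElim : Tendsto (fun m => E (y (φ m))) atTop (𝓝 (E y')) := by
    have h1 := hE y' hy'
    refine h1.tendsto.comp (tendsto_nhdsWithin_iff.2 ⟨hlim, Eventually.of_forall fun m => hy _⟩)
  have hinv : Tendsto (fun m => 1 / ((φ m : ℝ) + 1)) atTop (𝓝 0) :=
    tendsto_one_div_add_atTop_nhds_zero_nat.comp hφ.tendsto_atTop
  have hE1 : E y' ≤ 0 := by
    have h1 := hinv.mul hRlim
    rw [zero_mul] at h1
    refine le_of_tendsto_of_tendsto' hElim h1 fun m => ?_
    rw [one_div, ← div_eq_inv_mul, le_div_iff₀ (by positivity), mul_comm]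
    exact hyR _
  have hR0 : 0 ≤ R y' := by
    refine ge_of_tendsto' hRlim fun m => le_trans ?_ (hyR (φ m))
    exact mul_nonneg (by positivity) (hE0 _ (hy _))
  have hη' : η ≤ ‖y' - x‖ := by
    have : Tendsto (fun m => ‖y (φ m) - x‖) atTop (𝓝 ‖y' - x‖) := (hlim.sub_const x).norm
    exact ge_of_tendsto' this fun m => hyη _
  have h2 := hv y' hy' (le_antisymm hE1 (hE0 _ hy'))
  simp only [hR] at hR0
  nlinarith

/-- Necessary optimality conditions for the minimization of a lower
semicontinuous function over a closed set, under the basic qualification condition. -/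
theorem exists_mem_proximalLimitCone_neg_mem_basicSubdifferential [ProperSpace H] {h : H → EReal}
    {x : H} {Θ : Set H} {ρ : ℝ} (hρ : h x = (ρ : EReal)) (hΘ : IsClosed Θ) (hx : x ∈ Θ)
    (h_lsc : ∀ᶠ y in 𝓝 x, LowerSemicontinuousAt h y) (h_min : IsLocalMinOn h Θ x)
    (hQ : ∀ ξ ∈ proximalLimitCone x Θ, -ξ ∈ singularSubdifferential h x → ξ = 0) :
    ∃ ξ ∈ proximalLimitCone x Θ, -ξ ∈ basicSubdifferential h x := by
  obtain ⟨r, hr, hball⟩ : ∃ r > 0, ∀ y ∈ Metric.closedBall x r, LowerSemicontinuousAt h y ∧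
      (y ∈ Θ → (ρ : EReal) ≤ h y) ∧ ((ρ - 1 : ℝ) : EReal) < h y := by
    have h1 : ∀ᶠ y in 𝓝 x, y ∈ Θ → (ρ : EReal) ≤ h y := by
      have := eventually_nhdsWithin_iff.1 h_min
      rw [hρ] at this
      exact this
    have h2 : ∀ᶠ y in 𝓝 x, ((ρ - 1 : ℝ) : EReal) < h y := by
      refine h_lsc.self_of_nhds _ ?_
      change ((ρ - 1 : ℝ) : EReal) < h x
      rw [hρ, EReal.coe_lt_coe_iff]
      linarith
    exact Metric.nhds_basis_closedBall.eventually_iff.1 (h_lsc.and (h1.and h2))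
  set B := Metric.closedBall x r with hB
  have hBc : IsCompact B := isCompact_closedBall x r
  -- The epigraph point and the point of `Θ` vary independently. Truncating at `ρ + 1` gives
  -- compactness and is inactive near the limit, where the height tends to `ρ`.
  set S : Set ((H × ℝ) × H) :=
    {p | p.1.1 ∈ B ∧ h p.1.1 ≤ (p.1.2 : EReal) ∧ p.1.2 ≤ ρ + 1 ∧ p.2 ∈ Θ ∧ p.2 ∈ B} with hS
  have hepi : IsClosed {p : H × ℝ | p.1 ∈ B ∧ h p.1 ≤ (p.2 : EReal)} := by
    have h1 : IsClosed {p : H × EReal | p.1 ∈ B ∧ h p.1 ≤ p.2} :=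
      (lowerSemicontinuousOn_iff_isClosed_epigraph Metric.isClosed_closedBall).1
        fun y hy => (hball y hy).1.lowerSemicontinuousWithinAt B
    exact h1.preimage (f := fun p : H × ℝ => (p.1, (p.2 : EReal)))
      (continuous_fst.prodMk (continuous_coe_real_ereal.comp continuous_snd))
  have hSc : IsCompact S := by
    refine ((hBc.prod (isCompact_Icc (a := ρ - 1) (b := ρ + 1))).prod hBc).of_isClosed_subset ?_ ?_
    · have h1 : IsClosed {p : (H × ℝ) × H | p.1.1 ∈ B ∧ h p.1.1 ≤ (p.1.2 : EReal)} :=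
        hepi.preimage continuous_fst
      have h2 : IsClosed {p : (H × ℝ) × H | p.1.2 ≤ ρ + 1} := isClosed_le (by fun_prop) (by fun_prop)
      have h3 : IsClosed {p : (H × ℝ) × H | p.2 ∈ Θ ∧ p.2 ∈ B} :=
        (hΘ.inter Metric.isClosed_closedBall).preimage continuous_snd
      have h4 := (h1.inter h2).inter h3
      convert h4 using 1
      ext p
      simp only [hS, mem_ofPred_eq, mem_inter_iff]
      tauto
    · rintro p ⟨h1, h2, h3, h4, h5⟩
      refine ⟨⟨h1, ?_, h3⟩, h5⟩
      have := (hball _ h1).2.2.trans_le h2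
      exact (EReal.coe_lt_coe_iff.1 this).le
  have hxB : x ∈ B := Metric.mem_closedBall_self hr.le
  have hx0 : ((x, ρ), x) ∈ S := ⟨hxB, hρ.le, by simp, hx, hxB⟩
  -- The first quadratic term forces the two points together; the second forces their common limit
  -- to be `x`, even if `x` is not a strict minimizer.
  have hex : ∀ m : ℕ, ∃ p ∈ S, ∀ p' ∈ S,
      p.1.2 + ((m : ℝ) + 1) / 2 * ‖p.1.1 - p.2‖ ^ 2 + 1 / 2 * ‖p.1.1 - x‖ ^ 2 ≤
      p'.1.2 + ((m : ℝ) + 1) / 2 * ‖p'.1.1 - p'.2‖ ^ 2 + 1 / 2 * ‖p'.1.1 - x‖ ^ 2 := by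
    intro m
    obtain ⟨p, hp, hmin⟩ := hSc.exists_isMinOn ⟨_, hx0⟩ (f := fun p : (H × ℝ) × H =>
      p.1.2 + ((m : ℝ) + 1) / 2 * ‖p.1.1 - p.2‖ ^ 2 + 1 / 2 * ‖p.1.1 - x‖ ^ 2) (by fun_prop)
    exact ⟨p, hp, fun p' hp' => hmin hp'⟩
  choose p hp hpmin using hex
  have hval : ∀ m, (p m).1.2 + ((m : ℝ) + 1) / 2 * ‖(p m).1.1 - (p m).2‖ ^ 2 +
      1 / 2 * ‖(p m).1.1 - x‖ ^ 2 ≤ ρ := by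
    intro m
    have := hpmin m _ hx0
    simpa using this
  obtain ⟨p', hp', φ, hφ, hlim⟩ := hSc.tendsto_subseq hp
  have hlx : Tendsto (fun m => (p (φ m)).1.1) atTop (𝓝 p'.1.1) :=
    ((continuous_fst.comp continuous_fst).tendsto p').comp hlim
  have hlα : Tendsto (fun m => (p (φ m)).1.2) atTop (𝓝 p'.1.2) :=
    ((continuous_snd.comp continuous_fst).tendsto p').comp hlim
  have hly : Tendsto (fun m => (p (φ m)).2) atTop (𝓝 p'.2) := (continuous_snd.tendsto p').comp hlim
  have hinv : Tendsto (fun m => 1 / ((φ m : ℝ) + 1)) atTop (𝓝 0) :=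
    tendsto_one_div_add_atTop_nhds_zero_nat.comp hφ.tendsto_atTop
  have heq : p'.1.1 = p'.2 := by
    have h1 : Tendsto (fun m => ‖(p (φ m)).1.1 - (p (φ m)).2‖ ^ 2) atTop
        (𝓝 (‖p'.1.1 - p'.2‖ ^ 2)) := ((hlx.sub hly).norm).pow 2
    have h2 : ‖p'.1.1 - p'.2‖ ^ 2 ≤ 0 * 2 := by
      refine le_of_tendsto_of_tendsto' h1 (hinv.mul_const 2) fun m => ?_
      have h3 := hval (φ m)
      have h4 := EReal.coe_lt_coe_iff.1
        ((hball _ (hp (φ m)).1).2.2.trans_le (hp (φ m)).2.1)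
      rw [one_div, ← div_eq_inv_mul, le_div_iff₀ (by positivity)]
      nlinarith [sq_nonneg ‖(p (φ m)).1.1 - x‖]
    have h3 : ‖p'.1.1 - p'.2‖ = 0 := by nlinarith [norm_nonneg (p'.1.1 - p'.2)]
    exact sub_eq_zero.1 (norm_eq_zero.1 h3)
  have hvlim : p'.1.2 + 1 / 2 * ‖p'.1.1 - x‖ ^ 2 ≤ ρ := by
    have h1 : Tendsto (fun m => (p (φ m)).1.2 + 1 / 2 * ‖(p (φ m)).1.1 - x‖ ^ 2) atTop
        (𝓝 (p'.1.2 + 1 / 2 * ‖p'.1.1 - x‖ ^ 2)) :=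
      hlα.add ((((hlx.sub_const x).norm).pow 2).const_mul _)
    refine le_of_tendsto' h1 fun m => ?_
    have h3 := hval (φ m)
    have : 0 ≤ ((φ m : ℝ) + 1) / 2 * ‖(p (φ m)).1.1 - (p (φ m)).2‖ ^ 2 := by positivity
    linarith
  have hρ' : ρ ≤ p'.1.2 := by
    have h1 := (hball _ hp'.1).2.1 (heq ▸ hp'.2.2.2.1)
    exact EReal.coe_le_coe_iff.1 (h1.trans hp'.2.1)
  have hx' : p'.1.1 = x := by
    have h3 : ‖p'.1.1 - x‖ = 0 := by nlinarith [norm_nonneg (p'.1.1 - x)]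
    exact sub_eq_zero.1 (norm_eq_zero.1 h3)
  have hα' : p'.1.2 = ρ := by
    refine le_antisymm ?_ hρ'
    nlinarith [sq_nonneg ‖p'.1.1 - x‖]
  rw [hx'] at hlx
  rw [← heq, hx'] at hly
  rw [hα'] at hlα
  set X : ℕ → H := fun m => (p (φ m)).1.1 with hX
  set Y : ℕ → H := fun m => (p (φ m)).2 with hY
  set α : ℕ → ℝ := fun m => (p (φ m)).1.2 with hαdef
  set k : ℕ → ℝ := fun m => (φ m : ℝ) + 1 with hk
  have hkpos : ∀ m, 0 < k m := fun m => by positivity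
  set ξ : ℕ → H := fun m => k m • (X m - Y m) with hξ
  have hnB : B ∈ 𝓝 x := Metric.closedBall_mem_nhds x hr
  have hnormal : ∀ᶠ m in atTop, IsProximalNormal (ξ m) (Y m) Θ := by
    filter_upwards [hly.eventually (eventually_mem_nhds_iff.2 hnB)] with m hm
    refine ⟨(hp (φ m)).2.2.2.1, k m / 2, ?_⟩
    filter_upwards [nhdsWithin_le_nhds hm, self_mem_nhdsWithin] with y hyB hyΘ
    have h1 := hpmin (φ m) ((X m, α m), y) ⟨(hp (φ m)).1, (hp (φ m)).2.1, (hp (φ m)).2.2.1, hyΘ, hyB⟩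
    have h2 : k m / 2 * ‖X m - Y m‖ ^ 2 ≤ k m / 2 * ‖X m - y‖ ^ 2 := by
      simp only [hX, hY, hk, hαdef] at h1 ⊢
      linarith
    have h3 : X m - y = (X m - Y m) - (y - Y m) := by abel
    rw [h3, norm_sub_sq_real (X m - Y m) (y - Y m)] at h2
    simp only [hξ, real_inner_smul_left]
    nlinarith
  -- The scale `t` is left free: `t = l m` is used in the singular case and `t = 1` in the other.
  have hsub : ∀ᶠ m in atTop, ∀ t : ℝ, 0 ≤ t → IsProximalNormal
      (WithLp.toLp 2 (t • (-ξ m - (X m - x)), -t)) (WithLp.toLp 2 (X m, α m)) (epigraph h) := by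
    filter_upwards [hlx.eventually (eventually_mem_nhds_iff.2 hnB),
      hlα.eventually (gt_mem_nhds (show ρ < ρ + 1 by linarith))] with m hm hm2 t ht
    refine isProximalNormal_epigraph (C := t * ((k m + 1) / 2)) (hp (φ m)).2.1 ?_
    have hc1 : Tendsto (fun q : H × ℝ => q.1) (𝓝 (X m, α m)) (𝓝 (X m)) := continuous_fst.tendsto _
    have hc2 : Tendsto (fun q : H × ℝ => q.2) (𝓝 (X m, α m)) (𝓝 (α m)) := continuous_snd.tendsto _
    filter_upwards [hc1.eventually hm, hc2.eventually (gt_mem_nhds hm2)] with q hq1 hq2 hq3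
    have h1 := hpmin (φ m) (q, Y m) ⟨hq1, hq3, hq2.le, (hp (φ m)).2.2.2.1, (hp (φ m)).2.2.2.2⟩
    have h2 : α m + k m / 2 * ‖X m - Y m‖ ^ 2 + 1 / 2 * ‖X m - x‖ ^ 2 ≤
      q.2 + k m / 2 * ‖q.1 - Y m‖ ^ 2 + 1 / 2 * ‖q.1 - x‖ ^ 2 := h1
    have h3 : q.1 - Y m = (X m - Y m) + (q.1 - X m) := by abel
    have h4 : q.1 - x = (X m - x) + (q.1 - X m) := by abel
    rw [h3, h4, norm_add_sq_real, norm_add_sq_real] at h2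
    have h5 : inner ℝ (-ξ m - (X m - x)) (q.1 - X m) - (q.2 - α m) ≤
        (k m + 1) / 2 * ‖q.1 - X m‖ ^ 2 := by
      simp only [hξ, inner_sub_left (-(k m • (X m - Y m))), inner_neg_left, real_inner_smul_left]
      nlinarith
    rw [real_inner_smul_left]
    nlinarith [mul_le_mul_of_nonneg_left h5 ht]
  -- With this normalization the limits satisfy `‖ζ‖ + l' = 1`. If `l' = 0`, then `ζ` is a unit
  -- vector violating the qualification condition; if `l' > 0`, the `ξ` themselves converge along
  -- the subsequence.
  set l : ℕ → ℝ := fun m => (1 + ‖ξ m‖)⁻¹ with hl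
  have hl1 : ∀ m, 0 < 1 + ‖ξ m‖ := fun m => by positivity
  obtain ⟨⟨ζ, l'⟩, hζl, ψ, hψ, hlim2⟩ := ((isCompact_closedBall (0 : H) 1).prod
    (isCompact_Icc (a := (0 : ℝ)) (b := 1))).tendsto_subseq (x := fun m => (l m • ξ m, l m)) (by
      intro m
      refine ⟨?_, (inv_pos.2 (hl1 m)).le, inv_le_one_of_one_le₀ (by linarith [norm_nonneg (ξ m)])⟩
      rw [mem_closedBall_zero_iff, norm_smul, norm_inv, Real.norm_of_nonneg (hl1 m).le,
        ← div_eq_inv_mul, div_le_one (hl1 m)]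
      linarith)
  have hlζ : Tendsto (fun m => l (ψ m) • ξ (ψ m)) atTop (𝓝 ζ) :=
    (continuous_fst.tendsto (ζ, l')).comp hlim2
  have hll : Tendsto (fun m => l (ψ m)) atTop (𝓝 l') :=
    (continuous_snd.tendsto (ζ, l')).comp hlim2
  have hψt := hψ.tendsto_atTop
  have hnorm : ‖ζ‖ + l' = 1 := by
    refine tendsto_nhds_unique (hlζ.norm.add hll) ?_
    refine tendsto_const_nhds.congr fun m => ?_
    rw [norm_smul, norm_inv, Real.norm_of_nonneg (hl1 _).le]
    have := hl1 (ψ m)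
    simp only [hl]
    field_simp
    ring
  have hXx : Tendsto (fun m => X (ψ m) - x) atTop (𝓝 0) := by
    have := (hlx.comp hψt).sub_const x
    rwa [sub_self] at this
  have hbase : Tendsto (fun m => WithLp.toLp 2 (X (ψ m), α (ψ m))) atTop
      (𝓝 (WithLp.toLp 2 (x, ρ))) :=
    ((WithLp.prod_continuous_toLp 2 H ℝ).tendsto _).comp
      ((hlx.comp hψt).prodMk_nhds (hlα.comp hψt))
  have hxe : WithLp.toLp 2 (x, ρ) ∈ epigraph h := hρ.le
  rcases hζl.2.1.eq_or_lt with h0 | h0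
  · exfalso
    simp only at h0
    have h1 : ζ ∈ proximalLimitCone x Θ := by
      exact mem_proximalLimitCone_of_eventually ((hψt.eventually hnormal).mono fun m hm =>
        hm.smul (inv_pos.2 (hl1 _)).le) (hly.comp hψt) hlζ
    have h2 : -ζ ∈ singularSubdifferential h x := by
      refine ⟨ρ, hρ, ?_⟩
      refine mem_limitingNormalCone_of_eventually hxe
        (w := fun m => WithLp.toLp 2 (l (ψ m) • (-ξ (ψ m) - (X (ψ m) - x)), -l (ψ m)))
        ((hψt.eventually hsub).mono fun m hm => hm _ (inv_pos.2 (hl1 _)).le) hbase ?_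
      refine ((WithLp.prod_continuous_toLp 2 H ℝ).tendsto _).comp (Tendsto.prodMk_nhds ?_ ?_)
      · have := (hlζ.neg).sub (hll.smul hXx)
        simpa [smul_sub] using this
      · have := hll.neg
        rwa [← h0, neg_zero] at this
    have h3 := hQ ζ h1 h2
    rw [h3, norm_zero, ← h0] at hnorm
    norm_num at hnorm
  · simp only at h0
    have hξlim : Tendsto (fun m => ξ (ψ m)) atTop (𝓝 (l'⁻¹ • ζ)) := by
      refine ((hll.inv₀ h0.ne').smul hlζ).congr fun m => ?_
      rw [smul_smul, inv_mul_cancel₀ (inv_pos.2 (hl1 _)).ne', one_smul]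
    refine ⟨l'⁻¹ • ζ, mem_proximalLimitCone_of_eventually (hψt.eventually hnormal)
      (hly.comp hψt) hξlim, ρ, hρ, ?_⟩
    refine mem_limitingNormalCone_of_eventually hxe
      (w := fun m => WithLp.toLp 2 ((1 : ℝ) • (-ξ (ψ m) - (X (ψ m) - x)), -1))
      ((hψt.eventually hsub).mono fun m hm => hm _ zero_le_one) hbase ?_
    refine ((WithLp.prod_continuous_toLp 2 H ℝ).tendsto _).comp
      (Tendsto.prodMk_nhds ?_ tendsto_const_nhds)
    have := hξlim.neg.sub hXx
    simpa using this

end ProximalNormals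

/-! ### Tangent cones and normals of sublevel sets. -/

section SublevelSets

variable {H : Type*} [NormedAddCommGroup H] [InnerProductSpace ℝ H]

/-- Half of the residual of a projection onto the contingent cone of a closed set is a limit of
proximal normals to that set. -/
theorem half_smul_sub_mem_proximalLimitCone [ProperSpace H] {M : Set H} {x y w : H}
    (hM : IsClosed M) (hw : w ∈ contingentCone x M)
    (hmin : ∀ w' ∈ contingentCone x M, ‖y - w‖ ≤ ‖y - w'‖) :
    (1 / 2 : ℝ) • (y - w) ∈ proximalLimitCone x M := by
  obtain ⟨τ, u, hτ, hτ0, hu, hmem⟩ := id hw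
  -- The cone need not be convex, so `y` may have several nearest points. The midpoint `z` of `y`
  -- and `w` has `w` as its only nearest point, so the rescaled projections of `x + τ z` onto `M`
  -- converge to `w` along a subsequence.
  set b := (1 / 2 : ℝ) • (y - w) with hb
  set z := w + b with hz
  have hproj : ∀ k, ∃ m ∈ M, ∀ m' ∈ M, ‖x + τ k • z - m‖ ≤ ‖x + τ k • z - m'‖ := by
    intro k
    obtain ⟨m, hm, hd⟩ := hM.exists_infDist_eq_dist ⟨_, hmem k⟩ (x + τ k • z)
    refine ⟨m, hm, fun m' hm' => ?_⟩
    rw [← dist_eq_norm, ← dist_eq_norm, ← hd]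
    exact Metric.infDist_le_dist_of_mem hm'
  choose m hm hmm using hproj
  set ω : ℕ → H := fun k => (τ k)⁻¹ • (m k - x) with hω
  have hmω : ∀ k, m k = x + τ k • ω k := fun k => by
    simp only [hω]
    rw [smul_smul, mul_inv_cancel₀ (hτ k).ne', one_smul]
    abel
  have hle : ∀ k, ‖z - ω k‖ ≤ ‖z - u k‖ := by
    intro k
    have h1 := hmm k _ (hmem k)
    rw [hmω k, add_sub_add_left_eq_sub, add_sub_add_left_eq_sub, ← smul_sub, ← smul_sub, norm_smul,
      norm_smul, Real.norm_of_nonneg (hτ k).le] at h1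
    exact le_of_mul_le_mul_left h1 (hτ k)
  have hzu : Tendsto (fun k => ‖z - u k‖) atTop (𝓝 ‖z - w‖) := (hu.const_sub z).norm
  obtain ⟨B, hB⟩ := hzu.bddAbove_range
  have hωb : ∀ k, ω k ∈ Metric.closedBall z B := fun k => by
    rw [mem_closedBall_iff_norm']
    exact (hle k).trans (hB ⟨k, rfl⟩)
  obtain ⟨w', -, φ, hφ, hlim⟩ := (isCompact_closedBall z B).tendsto_subseq hωb
  have hτφ := hτ0.comp hφ.tendsto_atTop
  have hw'T : w' ∈ contingentCone x M :=
    ⟨τ ∘ φ, ω ∘ φ, fun k => hτ _, hτφ, hlim, fun k => by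
      simpa [← hmω] using hm (φ k)⟩
  have hw'le : ‖z - w'‖ ≤ ‖z - w‖ :=
    le_of_tendsto_of_tendsto' (hlim.const_sub z).norm (hzu.comp hφ.tendsto_atTop) fun k => hle _
  have hww : w' = w := by
    have h1 := hmin w' hw'T
    have h2 : y - w' = (y - w) - (w' - w) := by abel
    have h3 : z - w' = (1 / 2 : ℝ) • (y - w) - (w' - w) := by rw [hz, hb]; abel
    have h4 : z - w = (1 / 2 : ℝ) • (y - w) := by rw [hz, hb]; abel
    have h5 := pow_le_pow_left₀ (norm_nonneg _) h1 2
    have h6 := pow_le_pow_left₀ (norm_nonneg _) hw'le 2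
    rw [h2, norm_sub_sq_real (y - w)] at h5
    rw [h3, h4, norm_sub_sq_real ((1 / 2 : ℝ) • (y - w)), real_inner_smul_left] at h6
    have h7 : ‖w' - w‖ = 0 := by nlinarith [norm_nonneg (w' - w)]
    exact sub_eq_zero.1 (norm_eq_zero.1 h7)
  rw [hww] at hlim
  refine ⟨fun k => m (φ k), fun k => z - ω (φ k), fun k => ⟨hm _, (2 * τ (φ k))⁻¹, ?_⟩, ?_, ?_⟩
  · filter_upwards [self_mem_nhdsWithin] with m' hm'
    have h1 := pow_le_pow_left₀ (norm_nonneg _) (hmm (φ k) m' hm') 2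
    have h2 : x + τ (φ k) • z - m (φ k) = τ (φ k) • (z - ω (φ k)) := by
      rw [hmω, add_sub_add_left_eq_sub, ← smul_sub]
    have h3 : x + τ (φ k) • z - m' = τ (φ k) • (z - ω (φ k)) - (m' - m (φ k)) := by
      rw [← h2]; abel
    rw [h3, h2, norm_sub_sq_real (τ (φ k) • (z - ω (φ k))), real_inner_smul_left] at h1
    have h4 := hτ (φ k)
    rw [← div_eq_inv_mul, le_div_iff₀ (by positivity)]
    linarith
  · have h1 : Tendsto (fun k => x + τ (φ k) • ω (φ k)) atTop (𝓝 (x + (0 : ℝ) • w)) :=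
      tendsto_const_nhds.add (hτφ.smul hlim)
    rw [zero_smul, add_zero] at h1
    exact h1.congr fun k => (hmω _).symm
  · have h1 : Tendsto (fun k => z - ω (φ k)) atTop (𝓝 (z - w)) := hlim.const_sub z
    have h4 : z - w = b := by rw [hz]; abel
    rwa [h4] at h1

theorem eventually_abs_sub_le {X : Type*} [SeminormedAddCommGroup X] {g : X → ℝ} {U : Set X}
    {K : ℝ≥0} (hg : LipschitzOnWith K g U) {q : X} (hq : U ∈ 𝓝 q) : ∀ᶠ z in 𝓝 q, |g z - g q| ≤ K * ‖z - q‖ := by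
  filter_upwards [hq] with z hz
  have := hg.dist_le_mul z hz q (mem_of_mem_nhds hq)
  rwa [Real.dist_eq, dist_eq_norm] at this

/-- Proximal normals to a sublevel set of a locally Lipschitz function are approximated by multiples
of nearby proximal subgradients. -/
theorem IsProximalNormal.exists_near_proximalSubgradient [ProperSpace H] {g : H → ℝ} {U M : Set H}
    {K : ℝ≥0} (hg : LipschitzOnWith K g U) {p u : H} (hp : U ∈ 𝓝 p)
    (hM : ∀ y ∈ U, y ∈ M ↔ g y ≤ 0) (hu : IsProximalNormal u p M) {η : ℝ} (hη : 0 < η) :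
    ∃ q b : H, ‖q - p‖ < η ∧ ‖b - u‖ < η ∧
      (b = 0 ∨ ∃ (t : ℝ) (a : H), 0 ≤ t ∧ IsProximalSubgradient g q a ∧ b = t • a) := by
  obtain ⟨hpM, c, hc⟩ := hu
  obtain ⟨r, hr, hball⟩ := Metric.nhds_basis_closedBall.eventually_iff.1
    ((eventually_nhdsWithin_iff.1 hc).and (eventually_mem_nhds_iff.2 hp))
  have hsubU : Metric.closedBall p r ⊆ U := fun y hy => mem_of_mem_nhds (hball hy).2
  have hgp : max (g p) 0 = 0 := max_eq_right ((hM p (mem_of_mem_nhds hp)).1 hpM)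
  -- On the ball the zero set of `½ (g⁺)²` is that of `M`. The three bounds in `η` keep `q` near
  -- `p`, inside the ball, and keep the correction `2(c + 1)(q - p)` below the target error.
  obtain ⟨k, hk, q, hq, hmin⟩ := exists_penalty_minimizer (x := p) (v := u) (c := c)
    (η := min (min η r) (η / (2 * |c + 1| + 1))) hr
    (E := fun y => 1 / 2 * max (g y) 0 ^ 2)
    (continuousOn_const.mul (((hg.continuousOn.mono hsubU).sup continuousOn_const).pow 2))
    (fun y _ => by positivity) (by simp [hgp])
    (fun y hy hy0 => by
      refine (hball hy).1 ((hM y (hsubU hy)).2 ?_)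
      have h1 : max (g y) 0 = 0 := by
        have : max (g y) 0 ^ 2 = 0 := by linarith
        exact pow_eq_zero_iff (two_ne_zero) |>.1 this
      exact max_eq_right_iff.1 h1) (by positivity)
  have hqη : ‖q - p‖ < η := hq.trans_le ((min_le_left _ _).trans (min_le_left _ _))
  have hqr : ‖q - p‖ < r := hq.trans_le ((min_le_left _ _).trans (min_le_right _ _))
  have hqc : ‖q - p‖ < η / (2 * |c + 1| + 1) := hq.trans_le (min_le_right _ _)
  have hqb : Metric.closedBall p r ∈ 𝓝 q := by
    refine mem_of_superset (Metric.isOpen_ball.mem_nhds ?_) Metric.ball_subset_closedBall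
    rwa [mem_ball_iff_norm]
  refine ⟨q, u - (2 * (c + 1)) • (q - p), hqη, ?_, ?_⟩
  · rw [sub_sub_cancel_left, norm_neg, norm_smul, Real.norm_eq_abs, abs_mul, abs_two]
    rw [lt_div_iff₀ (by positivity)] at hqc
    nlinarith [norm_nonneg (q - p)]
  · refine eq_zero_or_eq_smul_of_posPart_sq (C := c + 1) hk
      (eventually_abs_sub_le hg (mem_of_superset hqb hsubU)) ?_
    filter_upwards [hqb] with z hz
    have h1 := hmin z hz
    have h2 : z - p = (q - p) + (z - q) := by abel
    rw [h2, inner_add_right, norm_add_sq_real (q - p)] at h1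
    rw [inner_sub_left, real_inner_smul_left]
    nlinarith

/-- Residuals of projections onto the contingent cone of a sublevel set are nonnegative multiples of
basic subgradients, provided that `0` is not a basic subgradient. -/
theorem sub_mem_conicHull_basicSubdifferential [ProperSpace H] {φ : H → EReal} {x y w : H}
    (hlsc : LowerSemicontinuous φ) (hlip : LipschitzAround φ x)
    (h0 : (0 : H) ∉ basicSubdifferential φ x) (hne : (basicSubdifferential φ x).Nonempty)
    (hw : w ∈ contingentCone x {z | φ z ≤ 0})
    (hmin : ∀ w' ∈ contingentCone x {z | φ z ≤ 0}, ‖y - w‖ ≤ ‖y - w'‖) :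
    y - w ∈ conicHull (basicSubdifferential φ x) := by
  rcases eq_or_ne (y - w) 0 with hyw | hyw
  · obtain ⟨v, hv⟩ := hne
    exact ⟨0, v, le_rfl, hv, by rw [hyw, zero_smul]⟩
  obtain ⟨U, hU, K, g, hg, hφg⟩ := hlip
  set M := {z | φ z ≤ 0} with hMdef
  have hMc : IsClosed M := hlsc.isClosed_preimage 0
  have hMU : ∀ y ∈ U, y ∈ M ↔ g y ≤ 0 := fun y hy => by
    simp only [hMdef, mem_ofPred_eq, hφg y hy]
    exact EReal.coe_le_coe_iff (y := 0)
  set u := (1 / 2 : ℝ) • (y - w) with hu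
  have hu0 : 0 < ‖u‖ := norm_pos_iff.2 (smul_ne_zero (by norm_num) hyw)
  obtain ⟨P, N, hN, hP, hNu⟩ := half_smul_sub_mem_proximalLimitCone hMc hw hmin
  have key : ∀ δ : ℝ, 0 < δ → ∃ (q a : H) (t : ℝ), ‖q - x‖ < δ ∧ ‖t • a - u‖ < δ ∧ 0 ≤ t ∧
      IsProximalSubgradient g q a ∧ ‖a‖ ≤ K := by
    intro δ hδ
    obtain ⟨ε, hε, hball⟩ := Metric.nhds_basis_ball.eventually_iff.1 (eventually_mem_nhds_iff.2 hU)
    -- The bound by `‖u‖` excludes the alternative `b = 0`; the bound by `ε` keeps `q` where the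
    -- Lipschitz estimate holds.
    set δ' := min δ (min ε ‖u‖) with hδ'
    have hδ'0 : 0 < δ' := by positivity
    obtain ⟨k, hk1, hk2, hk3⟩ := ((hP.eventually (Metric.ball_mem_nhds x (half_pos hδ'0))).and
      ((hNu.eventually (Metric.ball_mem_nhds u (half_pos hδ'0))).and
        (hP.eventually (eventually_mem_nhds_iff.2 hU)))).exists
    obtain ⟨q, b, hq, hb, hor⟩ := (hN k).exists_near_proximalSubgradient hg hk3 hMU (half_pos hδ'0)
    rw [dist_eq_norm] at hk1 hk2
    have hqx : ‖q - x‖ < δ' := by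
      have := norm_sub_le_norm_sub_add_norm_sub q (P k) x
      linarith
    have hbu : ‖b - u‖ < δ' := by
      have := norm_sub_le_norm_sub_add_norm_sub b (N k) u
      linarith
    rcases hor with rfl | ⟨t, a, ht, ha, rfl⟩
    · rw [zero_sub, norm_neg] at hbu
      exact absurd (hbu.trans_le ((min_le_right _ _).trans (min_le_right _ _))) (lt_irrefl _)
    · refine ⟨q, a, t, hqx.trans_le (min_le_left _ _), hbu.trans_le (min_le_left _ _), ht, ha,
        ha.norm_le K.2 (eventually_abs_sub_le hg (hball ?_))⟩
      rw [mem_ball_iff_norm]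
      exact hqx.trans_le ((min_le_right _ _).trans (min_le_left _ _))
  choose q a t hq htu ht ha haK using fun k : ℕ => key (1 / ((k : ℝ) + 1)) (by positivity)
  have hinv := tendsto_one_div_add_atTop_nhds_zero_nat (𝕜 := ℝ)
  have hqx : Tendsto q atTop (𝓝 x) :=
    tendsto_iff_norm_sub_tendsto_zero.2 (squeeze_zero (fun _ => norm_nonneg _) (fun k => (hq k).le) hinv)
  have htau : Tendsto (fun k => t k • a k) atTop (𝓝 u) :=
    tendsto_iff_norm_sub_tendsto_zero.2
      (squeeze_zero (fun _ => norm_nonneg _) (fun k => (htu k).le) hinv)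
  obtain ⟨a', -, ψ, hψ, hlim⟩ := (isCompact_closedBall (0 : H) K).tendsto_subseq (x := a) fun k => by
    rw [mem_closedBall_zero_iff]; exact haK k
  have ha' : a' ∈ basicSubdifferential φ x :=
    mem_basicSubdifferential_of_tendsto (eventually_of_mem hU hφg) (hg.continuousOn.continuousAt hU)
      (fun k => ha (ψ k)) (hqx.comp hψ.tendsto_atTop) hlim
  -- A nonzero limit subgradient prevents the multipliers from blowing up: `t = ‖t a‖ / ‖a‖`
  -- converges.
  have ha'0 : ‖a'‖ ≠ 0 := fun h => h0 (norm_eq_zero.1 h ▸ ha')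
  have htlim : Tendsto (fun k => t (ψ k)) atTop (𝓝 (‖u‖ / ‖a'‖)) := by
    have h1 : Tendsto (fun k => ‖t (ψ k) • a (ψ k)‖ / ‖a (ψ k)‖) atTop (𝓝 (‖u‖ / ‖a'‖)) :=
      (htau.comp hψ.tendsto_atTop).norm.div hlim.norm ha'0
    refine h1.congr' ?_
    filter_upwards [hlim.norm.eventually_ne ha'0] with k hk
    have hk : ‖a (ψ k)‖ ≠ 0 := hk
    rw [norm_smul, Real.norm_of_nonneg (ht _), mul_div_cancel_right₀ _ hk]
  have hfin : u = (‖u‖ / ‖a'‖) • a' :=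
    tendsto_nhds_unique (htau.comp hψ.tendsto_atTop) (htlim.smul hlim)
  refine ⟨2 * (‖u‖ / ‖a'‖), a', by positivity, ha', ?_⟩
  rw [mul_smul, ← hfin, hu, smul_smul]
  norm_num

theorem contingentCone_eq_univ {M : Set H} {x : H} (hM : M ∈ 𝓝 x) : contingentCone x M = univ := by
  refine eq_univ_of_forall fun w => ?_
  have h1 : Tendsto (fun k : ℕ => x + (1 / ((k : ℝ) + 1)) • w) atTop (𝓝 (x + (0 : ℝ) • w)) :=
    tendsto_const_nhds.add (tendsto_one_div_add_atTop_nhds_zero_nat.smul tendsto_const_nhds)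
  rw [zero_smul, add_zero] at h1
  obtain ⟨N, hN⟩ := eventually_atTop.1 (h1.eventually hM)
  refine ⟨fun k => 1 / (((k + N : ℕ) : ℝ) + 1), fun _ => w, fun k => by positivity,
    (tendsto_add_atTop_iff_nat N).2 tendsto_one_div_add_atTop_nhds_zero_nat, tendsto_const_nhds,
    fun k => hN (k + N) (by omega)⟩

theorem inner_nonpos_of_mem_contingentCone {M : Set H} {x v w : H} (hv : v ∈ regularNormalCone x M)
    (hw : w ∈ contingentCone x M) : inner ℝ v w ≤ 0 := by
  obtain ⟨τ, u, hτ, hτ0, hu, hmem⟩ := hw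
  have hx : Tendsto (fun k => x + τ k • u k) atTop (𝓝[M] x) := by
    refine tendsto_nhdsWithin_iff.2 ⟨?_, Eventually.of_forall hmem⟩
    have h1 : Tendsto (fun k => x + τ k • u k) atTop (𝓝 (x + (0 : ℝ) • w)) :=
      tendsto_const_nhds.add (hτ0.smul hu)
    rwa [zero_smul, add_zero] at h1
  have h1 : ∀ ε : ℝ, 0 < ε → inner ℝ v w ≤ ε * ‖w‖ := by
    intro ε hε
    refine le_of_tendsto_of_tendsto (tendsto_const_nhds.inner hu) (hu.norm.const_mul ε) ?_
    filter_upwards [hx.eventually (hv.2 ε hε)] with k hk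
    rw [add_sub_cancel_left, real_inner_smul_right, norm_smul, Real.norm_of_nonneg (hτ k).le] at hk
    have := hτ k
    exact le_of_mul_le_mul_left (by linarith) this
  refine le_of_forall_pos_le_add fun ε hε => ?_
  have h2 := h1 (ε / (‖w‖ + 1)) (by positivity)
  have h3 : ε / (‖w‖ + 1) * ‖w‖ ≤ ε := by
    rw [div_mul_eq_mul_div, div_le_iff₀ (by positivity)]
    nlinarith [norm_nonneg w]
  linarith

end SublevelSets

/-! ### Measurable selections from zero sets. -/

section Selections

variable {Ω : Type*} [MeasurableSpace Ω] {X : Type*} [MetricSpace X] [ProperSpace X]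

/-- By compactness, a zero in the closed ball exists iff approximate zeros from a dense sequence
exist in slightly larger balls, which is a countable condition. -/
theorem measurableSet_exists_zero_mem_closedBall {G : Ω → X → ℝ} (hm : ∀ w, Measurable fun ω => G ω w)
    (hc : ∀ ω, Continuous (G ω)) (h0 : ∀ ω w, 0 ≤ G ω w) (c : X) (r : ℝ) :
    MeasurableSet {ω | ∃ w ∈ Metric.closedBall c r, G ω w = 0} := by
  rcases isEmpty_or_nonempty X with hX | hX
  · exact hX.elim c
  set q := TopologicalSpace.denseSeq X with hq
  have hqd : DenseRange q := TopologicalSpace.denseRange_denseSeq X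
  have heq : {ω | ∃ w ∈ Metric.closedBall c r, G ω w = 0} =
      ⋂ m : ℕ, ⋃ i : ℕ, {ω | dist (q i) c ≤ r + 1 / ((m : ℝ) + 1) ∧ G ω (q i) < 1 / ((m : ℝ) + 1)} := by
    ext ω
    simp only [mem_ofPred_eq, mem_iInter, mem_iUnion]
    constructor
    · rintro ⟨w, hw, hGw⟩ m
      have hpos : 0 < 1 / ((m : ℝ) + 1) := by positivity
      obtain ⟨i, hi1, hi2⟩ := hqd.exists_mem_open
        (Metric.isOpen_ball.inter (isOpen_lt (g := fun _ => 1 / ((m : ℝ) + 1)) (hc ω) continuous_const))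
        ⟨w, Metric.mem_ball_self hpos, by simpa [hGw] using hpos⟩
      refine ⟨i, ?_, hi2⟩
      have h1 := dist_triangle (q i) w c
      have h2 : dist (q i) w < 1 / ((m : ℝ) + 1) := hi1
      have h3 : dist w c ≤ r := hw
      linarith
    · intro h
      choose i hi1 hi2 using h
      have hinv := tendsto_one_div_add_atTop_nhds_zero_nat (𝕜 := ℝ)
      obtain ⟨w, -, φ, hφ, hlim⟩ := (isCompact_closedBall c (r + 1)).tendsto_subseq
        (x := fun m => q (i m)) fun m => by
          refine (hi1 m).trans ?_
          have : 1 / ((m : ℝ) + 1) ≤ 1 := by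
            rw [div_le_one (by positivity)]
            linarith [Nat.cast_nonneg (α := ℝ) m]
          linarith
      refine ⟨w, ?_, le_antisymm ?_ (h0 _ _)⟩
      · have h1 : dist w c ≤ r + 0 :=
          le_of_tendsto_of_tendsto' (hlim.dist tendsto_const_nhds)
            ((hinv.comp hφ.tendsto_atTop).const_add r) fun m => hi1 _
        simpa using h1
      · exact le_of_tendsto_of_tendsto' (((hc ω).tendsto w).comp hlim)
          (hinv.comp hφ.tendsto_atTop) fun m => (hi2 _).le
  rw [heq]
  refine MeasurableSet.iInter fun m => MeasurableSet.iUnion fun i => ?_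
  exact (MeasurableSet.const _).inter (measurableSet_lt (hm _) measurable_const)

variable [MeasurableSpace X] [BorelSpace X]

/-- The zero sets of a nonnegative Carathéodory function have a measurable selection if they are
nonempty. -/
theorem exists_measurable_zero_selection {G : Ω → X → ℝ} (hm : ∀ w, Measurable fun ω => G ω w)
    (hc : ∀ ω, Continuous (G ω)) (h0 : ∀ ω w, 0 ≤ G ω w) (hex : ∀ ω, ∃ w, G ω w = 0) :
    ∃ s : Ω → X, Measurable s ∧ ∀ ω, G ω (s ω) = 0 := by
  classical
  rcases isEmpty_or_nonempty X with hX | hX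
  · exact ⟨fun ω => (hex ω).choose, measurable_of_empty_codomain _, fun ω => (hex ω).choose_spec⟩
  set q := TopologicalSpace.denseSeq X with hq
  have hqd : DenseRange q := TopologicalSpace.denseRange_denseSeq X
  -- Successive approximation: `q (N ω)` is within `2⁻ᵐ` of a zero. Taking the least admissible
  -- index keeps `N` measurable, and consecutive approximations are geometrically close.
  let good : ℕ → (Ω → ℕ) → Prop := fun m N => Measurable N ∧
    ∀ ω, ∃ w ∈ Metric.closedBall (q (N ω)) ((1 / 2) ^ m), G ω w = 0
  have hnear : ∀ (w : X) (m : ℕ), ∃ j, dist w (q j) ≤ (1 / 2) ^ m := fun w m => by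
    obtain ⟨j, hj⟩ := hqd.exists_dist_lt w (show (0 : ℝ) < (1 / 2) ^ m by positivity)
    exact ⟨j, hj.le⟩
  have hstart : ∃ N, good 0 N := by
    have hp : ∀ ω, ∃ j, ∃ w ∈ Metric.closedBall (q j) ((1 / 2) ^ 0), G ω w = 0 := fun ω => by
      obtain ⟨w, hw⟩ := hex ω
      obtain ⟨j, hj⟩ := hnear w 0
      exact ⟨j, w, hj, hw⟩
    exact ⟨fun ω => Nat.find (hp ω), measurable_find hp fun j =>
      measurableSet_exists_zero_mem_closedBall hm hc h0 _ _, fun ω => Nat.find_spec (hp ω)⟩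
  have hstep : ∀ m N, good m N → ∃ N', good (m + 1) N' ∧
      ∀ ω, dist (q (N ω)) (q (N' ω)) ≤ 2 * (1 / 2) ^ m := by
    rintro m N ⟨hNm, hN⟩
    have hp : ∀ ω, ∃ j, (∃ w ∈ Metric.closedBall (q j) ((1 / 2) ^ (m + 1)), G ω w = 0) ∧
        dist (q (N ω)) (q j) ≤ 2 * (1 / 2) ^ m := fun ω => by
      obtain ⟨w, hw, hGw⟩ := hN ω
      obtain ⟨j, hj⟩ := hnear w (m + 1)
      refine ⟨j, ⟨w, hj, hGw⟩, ?_⟩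
      have h1 := dist_triangle (q (N ω)) w (q j)
      have h2 : dist w (q (N ω)) ≤ (1 / 2) ^ m := hw
      rw [dist_comm] at h2
      have h3 : (1 / 2 : ℝ) ^ (m + 1) ≤ (1 / 2) ^ m :=
        pow_le_pow_of_le_one (by norm_num) (by norm_num) (by omega)
      linarith
    refine ⟨fun ω => Nat.find (hp ω), ⟨measurable_find hp fun j => ?_,
      fun ω => (Nat.find_spec (hp ω)).1⟩, fun ω => (Nat.find_spec (hp ω)).2⟩
    exact (measurableSet_exists_zero_mem_closedBall hm hc h0 _ _).inter
      (hNm (MeasurableSet.of_discrete (s := {i | dist (q i) (q j) ≤ 2 * (1 / 2) ^ m})))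
  obtain ⟨N0, hN0⟩ := hstart
  choose next hnext hdist using hstep
  let F : (m : ℕ) → {N : Ω → ℕ // good m N} := fun m =>
    Nat.rec ⟨N0, hN0⟩ (fun m N => ⟨next m N.1 N.2, hnext m N.1 N.2⟩) m
  have hFd : ∀ m ω, dist (q ((F m).1 ω)) (q ((F (m + 1)).1 ω)) ≤ 2 * (1 / 2) ^ m :=
    fun m ω => hdist m (F m).1 (F m).2 ω
  have hcau : ∀ ω, ∃ s, Tendsto (fun m => q ((F m).1 ω)) atTop (𝓝 s) := fun ω =>
    cauchySeq_tendsto_of_complete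
      (cauchySeq_of_le_geometric (1 / 2) 2 (by norm_num) fun m => hFd m ω)
  choose s hs using hcau
  refine ⟨s, ?_, fun ω => ?_⟩
  · refine measurable_of_tendsto_metrizable (f := fun m ω => q ((F m).1 ω)) (fun m => ?_)
      (tendsto_pi_nhds.2 hs)
    exact measurable_from_nat.comp (F m).2.1
  · choose w hw hGw using fun m => (F m).2.2 ω
    have hpow : Tendsto (fun m : ℕ => (1 / 2 : ℝ) ^ m) atTop (𝓝 0) :=
      tendsto_pow_atTop_nhds_zero_of_lt_one (by norm_num) (by norm_num)
    have hws : Tendsto w atTop (𝓝 (s ω)) := by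
      refine (hs ω).congr_dist ?_
      refine squeeze_zero (fun _ => dist_nonneg) (fun m => ?_) hpow
      rw [dist_comm]
      exact hw m
    refine tendsto_nhds_unique (((hc ω).tendsto _).comp hws) ?_
    simp only [Function.comp_def, hGw]
    exact tendsto_const_nhds

theorem exists_measurable_ae_zero_selection [Nonempty X] {μ : Measure Ω} {G : Ω → X → ℝ}
    (hm : ∀ w, Measurable fun ω => G ω w)
    (h : ∀ᵐ ω ∂μ, Continuous (G ω) ∧ (∀ w, 0 ≤ G ω w) ∧ ∃ w, G ω w = 0) :
    ∃ s : Ω → X, Measurable s ∧ ∀ᵐ ω ∂μ, G ω (s ω) = 0 := by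
  classical
  set S := (toMeasurable μ {ω | ¬ (Continuous (G ω) ∧ (∀ w, 0 ≤ G ω w) ∧ ∃ w, G ω w = 0)})ᶜ with hS
  have hSm : MeasurableSet S := (measurableSet_toMeasurable _ _).compl
  have hSg : ∀ ω ∈ S, Continuous (G ω) ∧ (∀ w, 0 ≤ G ω w) ∧ ∃ w, G ω w = 0 := fun ω hω => by
    by_contra hcon
    exact hω (subset_toMeasurable _ _ hcon)
  have hSμ : ∀ᵐ ω ∂μ, ω ∈ S := by
    rw [ae_iff]
    simpa [hS] using ae_iff.1 h
  obtain ⟨s, hs, hGs⟩ := exists_measurable_zero_selection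
    (G := fun ω w => if ω ∈ S then G ω w else 0)
    (fun w => Measurable.ite hSm (hm w) measurable_const)
    (fun ω => by
      by_cases hω : ω ∈ S
      · simpa [hω] using (hSg ω hω).1
      · simpa [hω] using continuous_const)
    (fun ω w => by
      by_cases hω : ω ∈ S
      · simpa [hω] using (hSg ω hω).2.1 w
      · simp [hω])
    (fun ω => by
      by_cases hω : ω ∈ S
      · simpa [hω] using (hSg ω hω).2.2
      · simp [hω])
  refine ⟨s, hs, ?_⟩
  filter_upwards [hSμ] with ω hω
  simpa [hω] using hGs ω

end Selections

/-! ### Penalization by an integral functional. -/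

section IntegralPenalty

variable {Ω : Type*} [MeasurableSpace Ω] {n : ℕ}

/-- Proximal normals to the common zero set of a family of functions with measurable quadratic upper
supports belong to the closed Aumann integral of the cones containing the supports. -/
theorem mem_closure_aumannIntegral {μ : Measure Ω} [SigmaFinite μ]
    {e : Ω → EuclideanSpace ℝ (Fin n) → ℝ} {C : Ω → Set (EuclideanSpace ℝ (Fin n))} {A : Set Ω}
    (hA : MeasurableSet A) (hC : ∀ ω (t : ℝ), 0 ≤ t → ∀ v ∈ C ω, t • v ∈ C ω)
    (hem : ∀ y, AEStronglyMeasurable (fun ω => e ω y) μ)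
    (he : ∀ y, ∀ᵐ ω ∂μ, 0 ≤ e ω y ∧ e ω y ≤ 1 / 2 * ‖y‖ ^ 2)
    (hu : ∀ y, ∃ u : Ω → EuclideanSpace ℝ (Fin n), AEStronglyMeasurable u μ ∧ ∀ᵐ ω ∂μ,
      ‖u ω‖ ≤ ‖y‖ ∧ (∀ y', e ω y' ≤ e ω y + inner ℝ (u ω) (y' - y) + 1 / 2 * ‖y' - y‖ ^ 2) ∧
      (ω ∈ A → u ω ∈ C ω) ∧ (ω ∉ A → u ω = 0))
    {x v : EuclideanSpace ℝ (Fin n)} (hv : IsProximalNormal v x {y | ∀ᵐ ω ∂μ, e ω y = 0}) :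
    v ∈ closure (aumannIntegral μ A C) := by
  -- A strictly positive integrable weight makes all integrals finite without changing the common
  -- zero set; the cones `C ω` absorb it.
  obtain ⟨δ, hδpos, hδm, hδlt⟩ := exists_pos_lintegral_lt_of_sigmaFinite μ (ε := 1) one_ne_zero
  set d : Ω → ℝ := fun ω => (δ ω : ℝ) with hd
  have hdpos : ∀ ω, 0 < d ω := fun ω => hδpos ω
  have hdm : Measurable d := hδm.coe_nnreal_real
  have hdint : Integrable d μ := by
    refine ⟨hdm.aestronglyMeasurable, ?_⟩
    rw [hasFiniteIntegral_iff_norm]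
    refine lt_of_le_of_lt (le_of_eq ?_) (hδlt.trans ENNReal.one_lt_top)
    refine lintegral_congr fun ω => ?_
    simp [hd]
  set D : ℝ := ∫ ω, d ω ∂μ with hD
  have hD0 : 0 ≤ D := integral_nonneg fun ω => (hdpos ω).le
  have hint : ∀ y, Integrable (fun ω => d ω * e ω y) μ := fun y => by
    refine (hdint.mul_const (1 / 2 * ‖y‖ ^ 2)).mono' (hdm.aestronglyMeasurable.mul (hem y)) ?_
    filter_upwards [he y] with ω hω
    rw [Real.norm_of_nonneg (mul_nonneg (hdpos ω).le hω.1)]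
    exact mul_le_mul_of_nonneg_left hω.2 (hdpos ω).le
  set E : EuclideanSpace ℝ (Fin n) → ℝ := fun y => ∫ ω, d ω * e ω y ∂μ with hE
  have hE0 : ∀ y, 0 ≤ E y := fun y => integral_nonneg_of_ae <| by
    filter_upwards [he y] with ω hω using mul_nonneg (hdpos ω).le hω.1
  choose u hum hu using hu
  have huint : ∀ y, Integrable (fun ω => d ω • u y ω) μ := fun y => by
    refine (hdint.mul_const ‖y‖).mono' (hdm.aestronglyMeasurable.smul (hum y)) ?_
    filter_upwards [hu y] with ω hω
    rw [norm_smul, Real.norm_of_nonneg (hdpos ω).le]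
    exact mul_le_mul_of_nonneg_left hω.1 (hdpos ω).le
  set V : EuclideanSpace ℝ (Fin n) → EuclideanSpace ℝ (Fin n) := fun y => ∫ ω, d ω • u y ω ∂μ with hV
  have hVnorm : ∀ y, ‖V y‖ ≤ D * ‖y‖ := fun y => by
    refine (norm_integral_le_of_norm_le (hdint.mul_const ‖y‖) ?_).trans (integral_mul_const _ _).le
    filter_upwards [hu y] with ω hω
    rw [norm_smul, Real.norm_of_nonneg (hdpos ω).le]
    exact mul_le_mul_of_nonneg_left hω.1 (hdpos ω).le
  have hupper : ∀ y y', E y' ≤ E y + inner ℝ (V y) (y' - y) + D / 2 * ‖y' - y‖ ^ 2 := fun y y' => by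
    have hi : Integrable (fun ω => inner ℝ (y' - y) (d ω • u y ω)) μ :=
      (huint y).const_inner (y' - y)
    have h1 : inner ℝ (V y) (y' - y) = ∫ ω, inner ℝ (y' - y) (d ω • u y ω) ∂μ := by
      rw [integral_inner (huint y), real_inner_comm]
    have h2 : D / 2 * ‖y' - y‖ ^ 2 = ∫ ω, d ω * (1 / 2 * ‖y' - y‖ ^ 2) ∂μ := by
      rw [integral_mul_const]; ring
    have hadd : Integrable (fun ω => d ω * e ω y + inner ℝ (y' - y) (d ω • u y ω)) μ :=
      (hint y).add hi
    rw [h1, h2, ← integral_add (hint y) hi, ← integral_add hadd (hdint.mul_const _)]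
    refine integral_mono_ae (hint y') (hadd.add (hdint.mul_const _)) ?_
    filter_upwards [hu y] with ω hω
    have h3 := mul_le_mul_of_nonneg_left (hω.2.1 y') (hdpos ω).le
    simp only [real_inner_smul_right, real_inner_comm (y' - y)] at h3 ⊢
    linarith
  have hEc : Continuous E := by
    refine continuous_iff_continuousAt.2 fun y => tendsto_iff_dist_tendsto_zero.2 ?_
    have hb : ∀ y1 y2, E y2 - E y1 ≤ D * ‖y1‖ * ‖y2 - y1‖ + D / 2 * ‖y2 - y1‖ ^ 2 := fun y1 y2 => by
      have h1 := hupper y1 y2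
      have h2 := real_inner_le_norm (V y1) (y2 - y1)
      have h3 := mul_le_mul_of_nonneg_right (hVnorm y1) (norm_nonneg (y2 - y1))
      linarith
    refine squeeze_zero (g := fun z => D * (‖y‖ + ‖z‖) * ‖z - y‖ + D / 2 * ‖z - y‖ ^ 2)
      (fun _ => dist_nonneg) (fun z => ?_) ?_
    · rw [Real.dist_eq, abs_le]
      have h1 := hb y z
      have h2 := hb z y
      rw [norm_sub_rev y z] at h2
      have h3 : 0 ≤ D * ‖y‖ * ‖z - y‖ := by positivity
      have h4 : 0 ≤ D * ‖z‖ * ‖z - y‖ := by positivity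
      constructor <;> nlinarith
    · have : Continuous fun z => D * (‖y‖ + ‖z‖) * ‖z - y‖ + D / 2 * ‖z - y‖ ^ 2 := by fun_prop
      simpa using this.tendsto y
  have hEz : ∀ y, E y = 0 → ∀ᵐ ω ∂μ, e ω y = 0 := fun y hy => by
    have h1 : 0 ≤ᵐ[μ] fun ω => d ω * e ω y := by
      filter_upwards [he y] with ω hω using mul_nonneg (hdpos ω).le hω.1
    filter_upwards [(integral_eq_zero_iff_of_nonneg_ae h1 (hint y)).1 hy] with ω hω
    exact (mul_eq_zero.1 hω).resolve_left (hdpos ω).ne'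
  obtain ⟨hx, c, hc⟩ := hv
  obtain ⟨r, hr, hball⟩ := Metric.nhds_basis_closedBall.eventually_iff.1
    (eventually_nhdsWithin_iff.1 hc)
  have hEx : E x = 0 := by
    refine integral_eq_zero_of_ae ?_
    filter_upwards [hx] with ω hω
    simp [hω]
  rw [Metric.mem_closure_iff]
  intro ε hε
  obtain ⟨k, hk, y, hy, hmin⟩ := exists_penalty_minimizer (x := x) (v := v) (c := c)
    (η := min r (ε / (2 * |c + 1| + 1))) hr hEc.continuousOn (fun y _ => hE0 y) hEx
    (fun y hy hy0 => hball hy (hEz y hy0)) (by positivity)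
  have hyr : ‖y - x‖ < r := hy.trans_le (min_le_left _ _)
  have hyε : ‖y - x‖ < ε / (2 * |c + 1| + 1) := hy.trans_le (min_le_right _ _)
  -- Differentiability of `E` is not needed: at a minimizer, an upper quadratic support of `E`
  -- already forces exact stationarity.
  have hgrad : v - (2 * (c + 1)) • (y - x) - k • V y = 0 := by
    refine eq_zero_of_eventually_inner_le (q := y) (C := c + 1 + k * (D / 2)) ?_
    have hqb : Metric.closedBall x r ∈ 𝓝 y := by
      refine mem_of_superset (Metric.isOpen_ball.mem_nhds ?_) Metric.ball_subset_closedBall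
      rwa [mem_ball_iff_norm]
    filter_upwards [hqb] with z hz
    have h1 := hmin z hz
    have h2 : z - x = (y - x) + (z - y) := by abel
    have h3 := mul_le_mul_of_nonneg_left (hupper y z) hk.le
    rw [h2, inner_add_right, norm_add_sq_real (y - x)] at h1
    rw [inner_sub_left, inner_sub_left, real_inner_smul_left, real_inner_smul_left]
    nlinarith
  refine ⟨k • V y, ⟨fun ω => k • d ω • u y ω, ((huint y).smul k).integrableOn, ?_, ?_⟩, ?_⟩
  · rw [ae_restrict_iff' hA]
    filter_upwards [hu y] with ω hω hωA
    exact hC _ _ hk.le _ (hC _ _ (hdpos ω).le _ (hω.2.2.1 hωA))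
  · rw [integral_smul]
    congr 1
    refine (setIntegral_eq_integral_of_ae_compl_eq_zero ?_).symm
    filter_upwards [hu y] with ω hω hωA
    rw [hω.2.2.2 hωA, smul_zero]
  · have h1 : v - k • V y = (2 * (c + 1)) • (y - x) := by
      rw [sub_right_comm] at hgrad
      exact sub_eq_zero.1 hgrad
    rw [dist_eq_norm, h1, norm_smul, Real.norm_eq_abs, abs_mul, abs_two]
    rw [lt_div_iff₀ (by positivity)] at hyε
    nlinarith [norm_nonneg (y - x)]

end IntegralPenalty

/-- If the supremum is finite, nearest points of the `F k` stay in a fixed compact ball, and a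
cluster point lies in every `F k`. Extended distances cover empty sets. -/
theorem infEDist_iInter_of_antitone {X : Type*} [MetricSpace X] [ProperSpace X] {F : ℕ → Set X}
    (hF : ∀ k, IsClosed (F k)) (hanti : Antitone F) (y : X) :
    Metric.infEDist y (⋂ k, F k) = ⨆ k, Metric.infEDist y (F k) := by
  refine le_antisymm ?_ (iSup_le fun k => Metric.infEDist_anti (iInter_subset F k))
  rcases eq_or_ne (⨆ k, Metric.infEDist y (F k)) ⊤ with htop | htop
  · rw [htop]; exact le_top
  have hlt : ∀ k, Metric.infEDist y (F k) ≠ ⊤ := fun k =>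
    ne_top_of_le_ne_top htop (le_iSup (fun k => Metric.infEDist y (F k)) k)
  have hne : ∀ k, (F k).Nonempty := fun k => by
    by_contra! hcon
    exact hlt k (by rw [hcon, Metric.infEDist_empty])
  have hex : ∀ k, ∃ u ∈ F k, edist y u ≤ ⨆ k, Metric.infEDist y (F k) := fun k => by
    obtain ⟨u, hu, hd⟩ := (hF k).exists_infDist_eq_dist (hne k) y
    refine ⟨u, hu, le_trans (le_of_eq ?_) (le_iSup (fun k => Metric.infEDist y (F k)) k)⟩
    rw [edist_dist, ← hd, Metric.infDist, ENNReal.ofReal_toReal (hlt k)]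
  choose u huF hu using hex
  obtain ⟨w, -, φ, hφ, hlim⟩ := (isCompact_closedBall y
    (⨆ k, Metric.infEDist y (F k)).toReal).tendsto_subseq (x := u) fun k => by
      rw [Metric.mem_closedBall, dist_comm, dist_edist]
      exact ENNReal.toReal_mono htop (hu k)
  have hw : w ∈ ⋂ k, F k := mem_iInter.2 fun k => (hF k).mem_of_tendsto hlim <| by
    filter_upwards [hφ.tendsto_atTop.eventually_ge_atTop k] with j hj using hanti hj (huF _)
  exact (Metric.infEDist_le_edist_of_mem hw).trans
    (le_of_tendsto' (tendsto_const_nhds.edist hlim) fun k => hu _)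

/-! ### Contingent cones as countable intersections. -/

section DifferenceQuotients

variable {H : Type*} [NormedAddCommGroup H] [InnerProductSpace ℝ H]

/-- The union of the sets `(M - x) / τ` over `0 < τ < 1 / (k + 1)`. -/
def quotientSet (x : H) (M : Set H) (k : ℕ) : Set H :=
  {u | ∃ τ : ℝ, 0 < τ ∧ τ < 1 / ((k : ℝ) + 1) ∧ x + τ • u ∈ M}

theorem quotientSet_antitone (x : H) (M : Set H) : Antitone (quotientSet x M) := by
  rintro i j hij u ⟨τ, h0, h1, h2⟩
  exact ⟨τ, h0, h1.trans_le (Nat.one_div_le_one_div hij), h2⟩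

theorem contingentCone_eq_iInter (x : H) (M : Set H) :
    contingentCone x M = ⋂ k, closure (quotientSet x M k) := by
  ext w
  rw [mem_iInter]
  constructor
  · rintro ⟨τ, u, hτ, hτ0, hu, hmem⟩ k
    refine mem_closure_of_tendsto hu ?_
    filter_upwards [hτ0.eventually (gt_mem_nhds (show (0 : ℝ) < 1 / ((k : ℝ) + 1) by positivity))]
      with j hj using ⟨τ j, hτ j, hj, hmem j⟩
  · intro h
    have hex : ∀ k : ℕ, ∃ u ∈ quotientSet x M k, dist w u < 1 / ((k : ℝ) + 1) := fun k =>
      Metric.mem_closure_iff.1 (h k) _ (by positivity)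
    choose u hu hd using hex
    choose τ hτ0 hτ1 hmem using hu
    have hinv := tendsto_one_div_add_atTop_nhds_zero_nat (𝕜 := ℝ)
    refine ⟨τ, u, hτ0, squeeze_zero (fun k => (hτ0 k).le) (fun k => (hτ1 k).le) hinv, ?_, hmem⟩
    rw [tendsto_iff_dist_tendsto_zero]
    refine squeeze_zero (fun _ => dist_nonneg) (fun k => ?_) hinv
    rw [dist_comm]
    exact (hd k).le

theorem isClosed_contingentCone (x : H) (M : Set H) : IsClosed (contingentCone x M) := by
  rw [contingentCone_eq_iInter]
  exact isClosed_iInter fun _ => isClosed_closure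

theorem infEDist_contingentCone [ProperSpace H] (x : H) (M : Set H) (y : H) :
    Metric.infEDist y (contingentCone x M) = ⨆ k, Metric.infEDist y (quotientSet x M k) := by
  rw [contingentCone_eq_iInter, infEDist_iInter_of_antitone (fun _ => isClosed_closure)
    fun i j hij => closure_mono (quotientSet_antitone x M hij)]
  simp only [Metric.infEDist_closure]

theorem zero_mem_contingentCone {x : H} {M : Set H} (hx : x ∈ M) : 0 ∈ contingentCone x M :=
  ⟨fun k => 1 / ((k : ℝ) + 1), fun _ => 0, fun k => by positivity,
    tendsto_one_div_add_atTop_nhds_zero_nat, tendsto_const_nhds, fun k => by simpa using hx⟩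

theorem smul_mem_conicHull {S : Set H} {t : ℝ} (ht : 0 ≤ t) {v : H} (hv : v ∈ conicHull S) :
    t • v ∈ conicHull S := by
  obtain ⟨s, w, hs, hw, rfl⟩ := hv
  exact ⟨t * s, w, mul_nonneg ht hs, hw, smul_smul _ _ _⟩

theorem LipschitzAround.sublevel_mem_nhds {X : Type*} [NormedAddCommGroup X] {φ : X → EReal}
    {x : X} (hlip : LipschitzAround φ x) (hx : φ x < 0) : {y | φ y ≤ 0} ∈ 𝓝 x := by
  obtain ⟨U, hU, K, g, hg, hfg⟩ := hlip
  rw [hfg x (mem_of_mem_nhds hU)] at hx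
  have hx : g x < 0 := EReal.coe_lt_coe_iff.1 hx
  filter_upwards [hU, (hg.continuousOn.continuousAt hU).eventually (gt_mem_nhds hx)] with y hy hgy
  rw [hfg y hy]
  exact EReal.coe_le_coe_iff.2 hgy.le

end DifferenceQuotients

/-! ### Multipliers under CHIP. -/

section Multipliers

variable {Ω : Type*} [MeasurableSpace Ω] {n : ℕ} {μ : Measure Ω}
  {f : Ω → EuclideanSpace ℝ (Fin n) → EReal}

/-- The distance is a countable supremum of distances to difference quotient sets. Such a distance
is below `r` exactly when `M ω` meets a fixed open set, a union over the uncountably many admissible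
`τ`. -/
theorem MeasurableMultifunction.measurable_infEDist_contingentCone
    {M : Ω → Set (EuclideanSpace ℝ (Fin n))} (hM : MeasurableMultifunction M)
    (x y : EuclideanSpace ℝ (Fin n)) :
    Measurable fun ω => Metric.infEDist y (contingentCone x (M ω)) := by
  simp only [infEDist_contingentCone]
  refine Measurable.iSup fun k => measurable_of_Iio fun r => ?_
  have hopen : IsOpen (⋃ τ ∈ Ioo (0 : ℝ) (1 / ((k : ℝ) + 1)),
      (fun z => τ⁻¹ • (z - x)) ⁻¹' Metric.eball y r) :=
    isOpen_biUnion fun τ _ => Metric.isOpen_eball.preimage (by fun_prop)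
  convert hM _ hopen using 1
  ext ω
  simp only [mem_preimage, mem_Iio, Metric.infEDist_lt_iff, mem_ofPred_eq]
  constructor
  · rintro ⟨u, ⟨τ, h0, h1, h2⟩, hu⟩
    refine ⟨_, h2, mem_biUnion (mem_Ioo.2 ⟨h0, h1⟩) ?_⟩
    rw [mem_preimage, add_sub_cancel_left, smul_smul, inv_mul_cancel₀ h0.ne', one_smul,
      Metric.mem_eball, edist_comm]
    exact hu
  · rintro ⟨z, hz, hzU⟩
    obtain ⟨τ, hτ, hzτ⟩ := mem_iUnion₂.1 hzU
    refine ⟨τ⁻¹ • (z - x), ⟨τ, hτ.1, hτ.2, ?_⟩, ?_⟩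
    · rw [smul_smul, mul_inv_cancel₀ hτ.1.ne', one_smul, add_sub_cancel]
      exact hz
    · rw [edist_comm]; exact hzτ

theorem IsNormalIntegrand.measurable_apply (hf : IsNormalIntegrand f)
    (x : EuclideanSpace ℝ (Fin n)) : Measurable fun ω => f ω x :=
  hf.measurable.comp measurable_prodMk_right

theorem IsNormalIntegrand.measurableSet_activeSet (hf : IsNormalIntegrand f)
    (x : EuclideanSpace ℝ (Fin n)) : MeasurableSet (activeSet f x) :=
  hf.measurable_apply x (measurableSet_singleton 0)

theorem IsNormalIntegrand.isClosed_constraintSet (hf : IsNormalIntegrand f) (ω : Ω) :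
    IsClosed (constraintSet f ω) :=
  (hf.lsc ω).isClosed_preimage 0

theorem isClosed_essInter {M : Ω → Set (EuclideanSpace ℝ (Fin n))} (hM : ∀ ω, IsClosed (M ω)) :
    IsClosed (essInter μ M) := by
  refine isClosed_of_closure_subset fun x hx => ?_
  obtain ⟨u, hu, hlim⟩ := mem_closure_iff_seq_limit.1 hx
  have h := ae_all_iff.2 hu
  filter_upwards [h] with ω hω using (hM ω).mem_of_tendsto hlim (Eventually.of_forall hω)

/-- The conic hull of the empty set is empty, so a single integrable selection suffices.
Nonemptiness is what allows a zero slope to be written as `0 • v`. -/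
theorem ae_nonempty_basicSubdifferential (hf : IsNormalIntegrand f) {x : EuclideanSpace ℝ (Fin n)}
    (h : (closedMultiplierSet μ f x).Nonempty) :
    ∀ᵐ ω ∂μ, ω ∈ activeSet f x → (basicSubdifferential (f ω) x).Nonempty := by
  obtain ⟨_, s, -, hs, -⟩ := closure_nonempty_iff.1 h
  rw [ae_restrict_iff' (hf.measurableSet_activeSet x)] at hs
  filter_upwards [hs] with ω hω hA
  obtain ⟨_, v, -, hv, -⟩ := hω hA
  exact ⟨v, hv⟩

/-- The integral penalty is applied at the origin to `½ dist²(·, T ω)`. By CHIP the common zero set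
is the contingent cone of the essential intersection, on which `v` is nonpositive; hence `v` is a
proximal normal there with constant `0`. -/
theorem mem_closedMultiplierSet_of_measurableCHIP [SigmaFinite μ] {x : EuclideanSpace ℝ (Fin n)}
    (hf : IsNormalIntegrand f) (hf_lip : ∀ᵐ ω ∂μ, LipschitzAround (f ω) x)
    (hM : MeasurableMultifunction (constraintSet f)) (hx : x ∈ essInter μ (constraintSet f))
    (hchip : MeasurableCHIP μ (constraintSet f) x)
    (h0 : ∀ᵐ ω ∂μ, ω ∈ activeSet f x → 0 ∉ basicSubdifferential (f ω) x)
    (hne : ∀ᵐ ω ∂μ, ω ∈ activeSet f x → (basicSubdifferential (f ω) x).Nonempty)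
    {v : EuclideanSpace ℝ (Fin n)} (hv : v ∈ regularNormalCone x (essInter μ (constraintSet f))) :
    v ∈ closedMultiplierSet μ f x := by
  set T : Ω → Set (EuclideanSpace ℝ (Fin n)) := fun ω => contingentCone x (constraintSet f ω) with hT
  have hTm : ∀ y, Measurable fun ω => Metric.infDist y (T ω) := fun y =>
    (hM.measurable_infEDist_contingentCone x y).ennreal_toReal
  have hT0 : ∀ᵐ ω ∂μ, 0 ∈ T ω := by
    filter_upwards [hx] with ω hω using zero_mem_contingentCone hω
  have hproj : ∀ y, ∃ s : Ω → EuclideanSpace ℝ (Fin n), Measurable s ∧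
      ∀ᵐ ω ∂μ, s ω ∈ T ω ∧ ‖y - s ω‖ = Metric.infDist y (T ω) := fun y => by
    obtain ⟨s, hs, hGs⟩ := exists_measurable_ae_zero_selection (μ := μ)
      -- The zeros of this function are the points of `T ω` nearest to `y`.
      (G := fun ω w => Metric.infDist w (T ω) + max (‖y - w‖ - Metric.infDist y (T ω)) 0)
      (fun w => (hTm w).add ((measurable_const.sub (hTm y)).max measurable_const)) (by
        filter_upwards [hT0] with ω hω
        refine ⟨?_, fun w => add_nonneg Metric.infDist_nonneg (le_max_right _ _), ?_⟩
        · exact (Metric.continuous_infDist_pt _).add (by fun_prop)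
        · obtain ⟨w, hw, hd⟩ := (isClosed_contingentCone x _).exists_infDist_eq_dist ⟨0, hω⟩ y
          refine ⟨w, ?_⟩
          rw [Metric.infDist_zero_of_mem hw, hd, dist_eq_norm, sub_self, max_self, add_zero])
    refine ⟨s, hs, ?_⟩
    filter_upwards [hGs, hT0] with ω hω hω0
    have h1 := Metric.infDist_nonneg (x := s ω) (s := T ω)
    have h2 := le_max_right (‖y - s ω‖ - Metric.infDist y (T ω)) 0
    have h3 := le_max_left (‖y - s ω‖ - Metric.infDist y (T ω)) 0
    have hmem : s ω ∈ T ω :=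
      ((isClosed_contingentCone x _).mem_iff_infDist_zero ⟨0, hω0⟩).2 (by linarith)
    refine ⟨hmem, le_antisymm (by linarith) ?_⟩
    rw [← dist_eq_norm]
    exact Metric.infDist_le_dist_of_mem hmem
  refine mem_closure_aumannIntegral (hf.measurableSet_activeSet x)
    (e := fun ω y => 1 / 2 * Metric.infDist y (T ω) ^ 2)
    (fun ω t ht v hv => smul_mem_conicHull ht hv)
    (fun y => (measurable_const.mul ((hTm y).pow_const 2)).aestronglyMeasurable) (fun y => ?_)
    (fun y => ?_) (x := 0) ?_
  · filter_upwards [hT0] with ω hω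
    have h1 : Metric.infDist y (T ω) ≤ ‖y‖ := by
      simpa using Metric.infDist_le_dist_of_mem (x := y) hω
    have h2 := pow_le_pow_left₀ Metric.infDist_nonneg h1 2
    exact ⟨by positivity, by linarith⟩
  · obtain ⟨s, hs, hsT⟩ := hproj y
    refine ⟨fun ω => y - s ω, (measurable_const.sub hs).aestronglyMeasurable, ?_⟩
    filter_upwards [hsT, hT0, h0, hne, hf_lip, hx] with ω h1 h2 h3 h4 h5 h6
    refine ⟨?_, fun y' => ?_, fun hA => ?_, fun hA => ?_⟩
    · rw [h1.2]
      simpa using Metric.infDist_le_dist_of_mem (x := y) h2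
    · have h7 := Metric.infDist_le_dist_of_mem (x := y') h1.1
      have h8 := pow_le_pow_left₀ Metric.infDist_nonneg h7 2
      have h9 : y' - s ω = (y - s ω) + (y' - y) := by abel
      rw [dist_eq_norm, h9, norm_add_sq_real (y - s ω), h1.2] at h8
      linarith
    · refine sub_mem_conicHull_basicSubdifferential (hf.lsc ω) h5 (h3 hA) (h4 hA) h1.1 fun w hw => ?_
      rw [h1.2, ← dist_eq_norm]
      exact Metric.infDist_le_dist_of_mem hw
    · have h7 : T ω = univ := contingentCone_eq_univ
        (h5.sublevel_mem_nhds (lt_of_le_of_ne h6 hA))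
      have h8 := h1.2
      rw [h7, Metric.infDist_zero_of_mem (mem_univ y)] at h8
      exact norm_eq_zero.1 h8
  · refine ⟨?_, 0, ?_⟩
    · filter_upwards [hT0] with ω hω
      rw [Metric.infDist_zero_of_mem hω]
      norm_num
    · filter_upwards [self_mem_nhdsWithin] with y hy
      have hyT : y ∈ contingentCone x (essInter μ (constraintSet f)) := by
        rw [hchip]
        filter_upwards [hy, hT0] with ω hω hω0
        refine ((isClosed_contingentCone x _).mem_iff_infDist_zero ⟨0, hω0⟩).2 ?_
        have : Metric.infDist y (T ω) ^ 2 = 0 := by linarith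
        exact pow_eq_zero_iff two_ne_zero |>.1 this
      simpa using inner_nonpos_of_mem_contingentCone hv hyT

end Multipliers

/-! ### The Moreau envelope of the squared positive part. -/

section EnvelopeCost

variable {X : Type*} [NormedAddCommGroup X]

/-- The cost defining the envelope of half the squared positive part of `g`. -/
noncomputable def envelopeCost (g : X → ℝ) (y w : X) : ℝ :=
  1 / 2 * ‖y - w‖ ^ 2 + 1 / 2 * max (g w) 0 ^ 2

theorem envelopeCost_nonneg (g : X → ℝ) (y w : X) : 0 ≤ envelopeCost g y w := by
  unfold envelopeCost; positivity

theorem continuous_envelopeCost {g : X → ℝ} (hg : Continuous g) (y : X) :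
    Continuous (envelopeCost g y) := by
  unfold envelopeCost; fun_prop

variable [ProperSpace X]

/-- The envelope of half the squared positive part of `g`, as an infimum over a dense sequence. -/
noncomputable def envelope (g : X → ℝ) (y : X) : ℝ :=
  ⨅ i : ℕ, envelopeCost g y (TopologicalSpace.denseSeq X i)

theorem envelope_nonneg (g : X → ℝ) (y : X) : 0 ≤ envelope g y :=
  le_ciInf fun _ => envelopeCost_nonneg g y _

/-- Continuity of the cost extends the bound from the dense sequence to all points; the countable
infimum keeps the envelope measurable in `ω`. -/
theorem envelope_le {g : X → ℝ} (hg : Continuous g) (y w : X) :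
    envelope g y ≤ envelopeCost g y w := by
  have hclosed : IsClosed {w | envelope g y ≤ envelopeCost g y w} :=
    isClosed_le continuous_const (continuous_envelopeCost hg y)
  refine (TopologicalSpace.denseRange_denseSeq X).induction_on w hclosed fun i => ?_
  exact ciInf_le ⟨0, by rintro _ ⟨j, rfl⟩; exact envelopeCost_nonneg g y _⟩ i

/-- Outside the ball of radius `‖y‖` about `y` the cost exceeds its value `½‖y‖²` at `w = 0`, so the
infimum is a minimum over a compact ball. -/
theorem exists_envelopeCost_eq {g : X → ℝ} (hg : Continuous g) (hg0 : g 0 = 0) (y : X) :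
    ∃ w, envelopeCost g y w = envelope g y := by
  obtain ⟨w, hw, hmin⟩ := (isCompact_closedBall y ‖y‖).exists_isMinOn ⟨y, by simp⟩
    (continuous_envelopeCost hg y).continuousOn
  have hc0 : envelopeCost g y 0 = 1 / 2 * ‖y‖ ^ 2 := by simp [envelopeCost, hg0]
  refine ⟨w, le_antisymm (le_ciInf fun i => ?_) (envelope_le hg y w)⟩
  generalize TopologicalSpace.denseSeq X i = z
  by_cases hz : z ∈ Metric.closedBall y ‖y‖
  · exact hmin hz
  · have h0 : envelopeCost g y w ≤ envelopeCost g y 0 := hmin (by simp)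
    refine h0.trans ?_
    rw [mem_closedBall_iff_norm', not_le] at hz
    have h1 := pow_le_pow_left₀ (norm_nonneg _) hz.le 2
    have h2 := sq_nonneg (max (g z) 0)
    rw [hc0, envelopeCost]
    linarith

theorem envelope_le_half_norm_sq {g : X → ℝ} (hg : Continuous g) (hg0 : g 0 = 0) (y : X) :
    envelope g y ≤ 1 / 2 * ‖y‖ ^ 2 := by
  simpa [envelopeCost, hg0] using envelope_le hg y 0

theorem envelope_eq_zero_iff {g : X → ℝ} (hg : Continuous g) (hg0 : g 0 = 0) (y : X) :
    envelope g y = 0 ↔ g y ≤ 0 := by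
  constructor
  · intro h
    obtain ⟨w, hw⟩ := exists_envelopeCost_eq hg hg0 y
    rw [h, envelopeCost] at hw
    have h1 := sq_nonneg ‖y - w‖
    have h2 := sq_nonneg (max (g w) 0)
    have h3 : ‖y - w‖ = 0 := pow_eq_zero_iff two_ne_zero |>.1 (by linarith)
    have h4 : max (g w) 0 = 0 := pow_eq_zero_iff two_ne_zero |>.1 (by linarith)
    rw [sub_eq_zero.1 (norm_eq_zero.1 h3)]
    exact max_eq_right_iff.1 h4
  · intro h
    refine le_antisymm ?_ (envelope_nonneg g y)
    simpa [envelopeCost, max_eq_right h] using envelope_le hg y y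

theorem norm_sub_le_of_envelopeCost_eq {g : X → ℝ} (hg : Continuous g) (hg0 : g 0 = 0) {y w : X}
    (hw : envelopeCost g y w = envelope g y) : ‖y - w‖ ≤ ‖y‖ := by
  have h1 := envelope_le_half_norm_sq hg hg0 y
  rw [← hw, envelopeCost] at h1
  have h2 := sq_nonneg (max (g w) 0)
  exact le_of_sq_le_sq (by linarith) (norm_nonneg y)

end EnvelopeCost

/-! ### Positively homogeneous functions and envelope slopes. -/

section Homogeneous

variable {H : Type*} [NormedAddCommGroup H] [InnerProductSpace ℝ H]

/-- A positively subhomogeneous function that is Lipschitz continuous around the origin is finite,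
positively homogeneous and globally Lipschitz continuous. -/
theorem LipschitzAround.exists_lipschitzWith {φ : H → EReal} (hlip : LipschitzAround φ 0)
    (hbot : ∀ x, φ x ≠ ⊥) (hhom : ∀ t : ℝ, 0 ≤ t → ∀ x, φ (t • x) ≤ (t : EReal) * φ x) :
    ∃ K : ℝ≥0, LipschitzWith K (fun x => (φ x).toReal) ∧ (∀ x, φ x = ((φ x).toReal : EReal)) ∧
      ∀ t : ℝ, 0 < t → ∀ x, (φ (t • x)).toReal = t * (φ x).toReal := by
  obtain ⟨U, hU, K, g, hg, hφg⟩ := hlip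
  have hsmall : ∀ x : H, ∀ᶠ t : ℝ in 𝓝[>] 0, t • x ∈ U := fun x => by
    have h1 : ContinuousAt (fun t : ℝ => t • x) 0 := by fun_prop
    have h2 : ∀ᶠ t : ℝ in 𝓝 0, t • x ∈ U := h1.eventually (by simpa using hU)
    exact h2.filter_mono nhdsWithin_le_nhds
  have hfin : ∀ x, φ x = ((φ x).toReal : EReal) := fun x => by
    refine (EReal.coe_toReal ?_ (hbot x)).symm
    obtain ⟨t, htU, ht⟩ := ((hsmall x).and self_mem_nhdsWithin).exists
    have ht : 0 < t := ht
    have h1 := hhom t⁻¹ (inv_nonneg.2 ht.le) (t • x)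
    rw [smul_smul, inv_mul_cancel₀ ht.ne', one_smul, hφg _ htU, ← EReal.coe_mul] at h1
    exact (h1.trans_lt (EReal.coe_lt_top _)).ne
  have hle : ∀ t : ℝ, 0 ≤ t → ∀ x, (φ (t • x)).toReal ≤ t * (φ x).toReal := fun t ht x => by
    have h1 := hhom t ht x
    rw [hfin (t • x), hfin x, ← EReal.coe_mul, EReal.coe_le_coe_iff] at h1
    exact h1
  have heq : ∀ t : ℝ, 0 < t → ∀ x, (φ (t • x)).toReal = t * (φ x).toReal := fun t ht x => by
    refine le_antisymm (hle t ht.le x) ?_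
    have h1 := hle t⁻¹ (inv_nonneg.2 ht.le) (t • x)
    rw [smul_smul, inv_mul_cancel₀ ht.ne', one_smul, ← div_eq_inv_mul, le_div_iff₀ ht] at h1
    linarith
  refine ⟨K, LipschitzWith.of_dist_le_mul fun x y => ?_, hfin, heq⟩
  -- Both points are shrunk into `U`; homogeneity makes the local Lipschitz constant global.
  obtain ⟨t, ⟨hxU, hyU⟩, ht⟩ := (((hsmall x).and (hsmall y)).and self_mem_nhdsWithin).exists
  have ht : 0 < t := ht
  have h1 := hg.dist_le_mul _ hxU _ hyU
  have h2 : ∀ z, t • z ∈ U → g (t • z) = t * (φ z).toReal := fun z hz => by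
    rw [← heq t ht z, hφg _ hz, EReal.toReal_coe]
  rw [h2 x hxU, h2 y hyU, Real.dist_eq, ← mul_sub, abs_mul, abs_of_pos ht, dist_smul₀,
    Real.norm_of_nonneg ht.le, ← Real.dist_eq] at h1
  exact le_of_mul_le_mul_left (by linarith) ht

theorem IsProximalSubgradient.smul_of_homogeneous {g : H → ℝ}
    (hg : ∀ t : ℝ, 0 < t → ∀ x, g (t • x) = t * g x) {w a : H} (ha : IsProximalSubgradient g w a)
    {t : ℝ} (ht : 0 < t) : IsProximalSubgradient g (t • w) a := by
  obtain ⟨C, hC⟩ := ha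
  refine ⟨C / t, ?_⟩
  have hc : Tendsto (fun z : H => t⁻¹ • z) (𝓝 (t • w)) (𝓝 w) := by
    have h1 : Continuous fun z : H => t⁻¹ • z := by fun_prop
    have h2 := h1.tendsto (t • w)
    rwa [smul_smul, inv_mul_cancel₀ ht.ne', one_smul] at h2
  filter_upwards [hc.eventually hC] with z hz
  set z' := t⁻¹ • z with hz'
  have hzz : z = t • z' := by rw [hz', smul_smul, mul_inv_cancel₀ ht.ne', one_smul]
  rw [hzz, hg t ht, hg t ht, ← smul_sub, real_inner_smul_right, norm_smul,
    Real.norm_of_nonneg ht.le]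
  have h1 : C / t * (t * ‖z' - w‖) ^ 2 = t * (C * ‖z' - w‖ ^ 2) := by
    field_simp
  rw [h1]
  nlinarith

/-- The same vector is a proximal subgradient at every point `w / (k + 1)`, and these tend to `0`.
The quadratic constants grow with `k`, which is harmless because they may depend on the point. -/
theorem IsProximalSubgradient.mem_basicSubdifferential_zero {φ : H → EReal} {g : H → ℝ}
    (hφ : ∀ x, φ x = (g x : EReal)) (hgc : Continuous g)
    (hg : ∀ t : ℝ, 0 < t → ∀ x, g (t • x) = t * g x) {w a : H} (ha : IsProximalSubgradient g w a) :
    a ∈ basicSubdifferential φ 0 := by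
  refine mem_basicSubdifferential_of_tendsto (Eventually.of_forall hφ) hgc.continuousAt
    (q := fun k : ℕ => (1 / ((k : ℝ) + 1)) • w) (b := fun _ => a)
    (fun k => ha.smul_of_homogeneous hg (by positivity)) ?_ tendsto_const_nhds
  have h1 : Tendsto (fun k : ℕ => (1 / ((k : ℝ) + 1)) • w) atTop (𝓝 ((0 : ℝ) • w)) :=
    tendsto_one_div_add_atTop_nhds_zero_nat.smul tendsto_const_nhds
  rwa [zero_smul] at h1

variable [ProperSpace H]

theorem envelope_le_add {g : H → ℝ} (hg : Continuous g) {y w : H}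
    (hw : envelopeCost g y w = envelope g y) (y' : H) :
    envelope g y' ≤ envelope g y + inner ℝ (y - w) (y' - y) + 1 / 2 * ‖y' - y‖ ^ 2 := by
  have h1 := envelope_le hg y' w
  have h2 : y' - w = (y - w) + (y' - y) := by abel
  rw [← hw]
  unfold envelopeCost at h1 ⊢
  rw [h2, norm_add_sq_real (y - w)] at h1
  linarith

/-- Minimality of `w` in the cost says that `y - w` is the slope of a quadratic minorant of `½
(g⁺)²` at `w`. -/
theorem sub_eq_zero_or_eq_smul_of_envelopeCost_eq {g : H → ℝ} {K : ℝ≥0} (hg : LipschitzWith K g)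
    {y w : H} (hw : envelopeCost g y w = envelope g y) :
    y - w = 0 ∨ ∃ (t : ℝ) (a : H), 0 ≤ t ∧ IsProximalSubgradient g w a ∧ y - w = t • a := by
  refine eq_zero_or_eq_smul_of_posPart_sq (k := 1) (C := 1 / 2) one_pos
    (eventually_abs_sub_le hg.lipschitzOnWith univ_mem) (Eventually.of_forall fun z => ?_)
  have h1 := envelope_le hg.continuous y z
  have h2 : y - z = (y - w) - (z - w) := by abel
  rw [← hw] at h1
  unfold envelopeCost at h1
  rw [h2, norm_sub_sq_real (y - w)] at h1
  linarith

end Homogeneous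

/-! ### Multipliers in the homogeneous case, and the optimality condition. -/

section HomogeneousMultipliers

variable {Ω : Type*} [MeasurableSpace Ω] {n : ℕ} {μ : Measure Ω}
  {f : Ω → EuclideanSpace ℝ (Fin n) → EReal}

/-- The integral penalty is applied to the envelopes at any point `x` of the essential intersection,
although the subgradients are taken at `0`. Almost every index is active, since homogeneity forces
`f ω 0 = 0`. -/
theorem mem_closedMultiplierSet_of_subhomogeneous [SigmaFinite μ] (hf : IsNormalIntegrand f)
    (hf_lip : ∀ᵐ ω ∂μ, LipschitzAround (f ω) 0)
    (hhom : ∀ᵐ ω ∂μ, ∀ t : ℝ, 0 ≤ t → ∀ x, f ω (t • x) ≤ (t : EReal) * f ω x)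
    (hne : ∀ᵐ ω ∂μ, ω ∈ activeSet f 0 → (basicSubdifferential (f ω) 0).Nonempty)
    {x v : EuclideanSpace ℝ (Fin n)}
    (hv : IsProximalNormal v x (essInter μ (constraintSet f))) :
    v ∈ closedMultiplierSet μ f 0 := by
  set g : Ω → EuclideanSpace ℝ (Fin n) → ℝ := fun ω x => (f ω x).toReal with hgdef
  have hgood : ∀ᵐ ω ∂μ, (∃ K : ℝ≥0, LipschitzWith K (g ω)) ∧ (∀ x, f ω x = (g ω x : EReal)) ∧
      (∀ t : ℝ, 0 < t → ∀ x, g ω (t • x) = t * g ω x) ∧ g ω 0 = 0 := by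
    filter_upwards [hf_lip, hhom] with ω h1 h2
    obtain ⟨K, hK, h3, h4⟩ := h1.exists_lipschitzWith (hf.ne_bot ω) h2
    refine ⟨⟨K, hK⟩, h3, h4, ?_⟩
    have h5 := h4 2 two_pos 0
    rw [smul_zero] at h5
    change (f ω 0).toReal = 0
    linarith
  have hgm : ∀ w, Measurable fun ω => g ω w := fun w => (hf.measurable_apply w).ereal_toReal
  have hcm : ∀ y w, Measurable fun ω => envelopeCost (g ω) y w := fun y w =>
    measurable_const.add (measurable_const.mul (((hgm w).max measurable_const).pow_const 2))
  have hem : ∀ y, Measurable fun ω => envelope (g ω) y := fun y => Measurable.iInf fun i => hcm y _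
  have hsel : ∀ y, ∃ s : Ω → EuclideanSpace ℝ (Fin n), Measurable s ∧
      ∀ᵐ ω ∂μ, envelopeCost (g ω) y (s ω) = envelope (g ω) y := fun y => by
    obtain ⟨s, hs, hGs⟩ := exists_measurable_ae_zero_selection (μ := μ)
      (G := fun ω w => envelopeCost (g ω) y w - envelope (g ω) y)
      (fun w => (hcm y w).sub (hem y)) (by
        filter_upwards [hgood] with ω ⟨⟨K, hK⟩, _, _, h0⟩
        refine ⟨(continuous_envelopeCost hK.continuous y).sub continuous_const,
          fun w => sub_nonneg.2 (envelope_le hK.continuous y w), ?_⟩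
        obtain ⟨w, hw⟩ := exists_envelopeCost_eq hK.continuous h0 y
        exact ⟨w, sub_eq_zero.2 hw⟩)
    exact ⟨s, hs, hGs.mono fun ω hω => sub_eq_zero.1 hω⟩
  have hact : ∀ᵐ ω ∂μ, ω ∈ activeSet f 0 := by
    filter_upwards [hgood] with ω ⟨_, h1, _, h0⟩
    change f ω 0 = 0
    rw [h1 0, h0, EReal.coe_zero]
  have hset : essInter μ (constraintSet f) = {y | ∀ᵐ ω ∂μ, envelope (g ω) y = 0} := by
    ext y
    change (∀ᵐ ω ∂μ, y ∈ constraintSet f ω) ↔ ∀ᵐ ω ∂μ, envelope (g ω) y = 0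
    refine eventually_congr ?_
    filter_upwards [hgood] with ω ⟨⟨K, hK⟩, h1, _, h0⟩
    rw [envelope_eq_zero_iff hK.continuous h0]
    change f ω y ≤ 0 ↔ _
    rw [h1 y]
    exact EReal.coe_le_coe_iff (y := 0)
  rw [hset] at hv
  refine mem_closure_aumannIntegral (hf.measurableSet_activeSet 0)
    (fun ω t ht v hv => smul_mem_conicHull ht hv) (fun y => (hem y).aestronglyMeasurable)
    (fun y => ?_) (fun y => ?_) hv
  · filter_upwards [hgood] with ω ⟨⟨K, hK⟩, _, _, h0⟩
    exact ⟨envelope_nonneg _ _, envelope_le_half_norm_sq hK.continuous h0 y⟩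
  · obtain ⟨s, hs, hsw⟩ := hsel y
    refine ⟨fun ω => y - s ω, (measurable_const.sub hs).aestronglyMeasurable, ?_⟩
    filter_upwards [hgood, hsw, hact, hne] with ω ⟨⟨K, hK⟩, h1, h2, h0⟩ hw hA hne
    refine ⟨norm_sub_le_of_envelopeCost_eq hK.continuous h0 hw, envelope_le_add hK.continuous hw,
      fun _ => ?_, fun hA' => absurd hA hA'⟩
    rcases sub_eq_zero_or_eq_smul_of_envelopeCost_eq hK hw with h | ⟨t, a, ht, ha, h⟩
    · obtain ⟨a, ha⟩ := hne hA
      exact ⟨0, a, le_rfl, ha, by rw [h, zero_smul]⟩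
    · exact ⟨t, a, ht, ha.mem_basicSubdifferential_zero h1 hK.continuous h2, h⟩

/-- Optimality condition for the minimization over the essential intersection, once the limits of
proximal normals are known to be multipliers. -/
theorem zero_mem_basicSubdifferential_add_closedMultiplierSet
    {h : EuclideanSpace ℝ (Fin n) → EReal} {x : EuclideanSpace ℝ (Fin n)}
    (h_lsc : ∀ᶠ y in 𝓝 x, LowerSemicontinuousAt h y) (hf : IsNormalIntegrand f)
    (h_feas : x ∈ essInter μ (constraintSet f))
    (h_min : IsLocalMinOn h (essInter μ (constraintSet f)) x)
    (hN : proximalLimitCone x (essInter μ (constraintSet f)) ⊆ closedMultiplierSet μ f x)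
    (hQ : (-singularSubdifferential h x) ∩ closedMultiplierSet μ f x = {0}) :
    0 ∈ basicSubdifferential h x + closedMultiplierSet μ f x := by
  -- Since the qualification condition is an equality, it makes the singular subdifferential
  -- nonempty, and hence `h x` finite.
  have h0 : (0 : EuclideanSpace ℝ (Fin n)) ∈
      (-singularSubdifferential h x) ∩ closedMultiplierSet μ f x := by
    rw [hQ]; exact mem_singleton _
  obtain ⟨ρ, hρ, -⟩ := h0.1
  obtain ⟨ξ, hξ, hξh⟩ := exists_mem_proximalLimitCone_neg_mem_basicSubdifferential hρ
    (isClosed_essInter hf.isClosed_constraintSet) h_feas h_lsc h_min fun ξ hξ hξs => by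
      have h1 : ξ ∈ (-singularSubdifferential h x) ∩ closedMultiplierSet μ f x := ⟨hξs, hN hξ⟩
      rwa [hQ] at h1
  exact ⟨-ξ, hξh, ξ, hN hξ, neg_add_cancel ξ⟩

end HomogeneousMultipliers

end StochVar

theorem corollary6p3 {Ω : Type*} [MeasurableSpace Ω] (μ : Measure Ω) [SigmaFinite μ]
    [μ.IsComplete] {n : ℕ}
    (h : EuclideanSpace ℝ (Fin n) → EReal) (f : Ω → EuclideanSpace ℝ (Fin n) → EReal)
    (xbar : EuclideanSpace ℝ (Fin n))
    (h_ne_bot : ∀ x, h x ≠ ⊥)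
    (h_lsc : ∀ᶠ x in 𝓝 xbar, LowerSemicontinuousAt h x)
    (hf : StochVar.IsNormalIntegrand f)
    (hf_lip : ∀ᵐ ω ∂μ, StochVar.LipschitzAround (f ω) xbar)
    (hM : StochVar.MeasurableMultifunction (StochVar.constraintSet f))
    (h_feas : xbar ∈ StochVar.essInter μ (StochVar.constraintSet f))
    (h_min : IsLocalMinOn h (StochVar.essInter μ (StochVar.constraintSet f)) xbar) :
    -- (i) the general case
    (StochVar.NormallyRegularAt (StochVar.essInter μ (StochVar.constraintSet f)) xbar →
      StochVar.MeasurableCHIP μ (StochVar.constraintSet f) xbar →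
      (∀ᵐ ω ∂μ, ω ∈ StochVar.activeSet f xbar → 0 ∉ StochVar.basicSubdifferential (f ω) xbar) →
      (-StochVar.singularSubdifferential h xbar) ∩ StochVar.closedMultiplierSet μ f xbar = {0} →
      0 ∈ StochVar.basicSubdifferential h xbar + StochVar.closedMultiplierSet μ f xbar) ∧
    -- (ii) the positively subhomogeneous case at the origin
    (xbar = 0 →
      (∀ᵐ ω ∂μ, ∀ t : ℝ, 0 ≤ t → ∀ x, f ω (t • x) ≤ (t : EReal) * f ω x) →
      (-StochVar.singularSubdifferential h xbar) ∩ StochVar.closedMultiplierSet μ f xbar = {0} →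
      0 ∈ StochVar.basicSubdifferential h xbar + StochVar.closedMultiplierSet μ f xbar) := by
  refine ⟨fun hreg hchip h0 hQ => ?_, fun hx hhom hQ => ?_⟩
  · have hne := StochVar.ae_nonempty_basicSubdifferential (μ := μ) hf (x := xbar)
      ⟨0, (hQ.ge (mem_singleton 0)).2⟩
    refine StochVar.zero_mem_basicSubdifferential_add_closedMultiplierSet h_lsc hf h_feas h_min
      (fun v hv => ?_) hQ
    obtain ⟨y, w, hw, hy, hwv⟩ := hv
    have hv := StochVar.mem_limitingNormalCone_of_eventually h_feas (Eventually.of_forall hw) hy hwv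
    -- Regularity moves the limiting normal to a regular normal at `xbar` itself, where CHIP
    -- applies.
    rw [← hreg] at hv
    exact StochVar.mem_closedMultiplierSet_of_measurableCHIP hf hf_lip hM h_feas hchip h0 hne hv
  · subst hx
    have hne := StochVar.ae_nonempty_basicSubdifferential (μ := μ) hf (x := 0)
      ⟨0, (hQ.ge (mem_singleton 0)).2⟩
    refine StochVar.zero_mem_basicSubdifferential_add_closedMultiplierSet h_lsc hf h_feas h_min
      (fun v hv => ?_) hQ
    obtain ⟨y, w, hw, -, hwv⟩ := hv
    -- Normals at the nearby points are already multipliers at `0`, so closedness replaces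
    -- regularity.
    exact isClosed_closure.mem_of_tendsto hwv (Eventually.of_forall fun k =>
      StochVar.mem_closedMultiplierSet_of_subhomogeneous hf hf_lip hhom hne (hw k))
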